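/- **Setting.** A function $f\in C^\infty(0,\infty)$ is *completely monotone* if $(-1)^n f^{(n)}\ge 0$ on $(0,\infty)$ for all $n\ge 0$. A function $g\in C^\infty(0,\infty)$ is a *Bernstein function* if $g\ge 0$ and $(-1)^n g^{(n)}\le 0$ on $(0,\infty)$ for all $n\ge 1$. A *potential* is a completely monotone function of the form $f=1/g$ on $(0,\infty)$ with $g\neq 0$ a Bernstein function. Let $\mathbb{R}_+=[0,\infty)$ and $\mathbb{C}_+=\{z\in\mathbb C:\operatorname{Re} z>0\}$. Let $X$ be a complex Banach space and let $-A$ be the generator of a bounded $C_0$-semigroup $(T(s))_{s\ge 0}$ on $X$. For $t>0$ and $x\in X$ put $C_t(A)x=\frac1t\int_0^t T(s)x\,ds$. Let $M(\mathbb{R}_+)$ be the space of bounded complex Radon measures on $\mathbb{R}_+$. For $\nu\in M(\mathbb{R}_+)$ let $(\mathcal L\nu)(z)=\int_{\mathbb{R}_+} e^{-sz}\,\nu(ds)$, and for $e=\mathcal L\nu$ let $e(A)x=\int_{\mathbb{R}_+}T(s)x\,\nu(ds)$. If $g:\mathbb{C}_+\to\mathbb C$ is holomorphic and there is $e\in\mathcal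 L(M(\mathbb{R}_+))$ such that $eg\in\mathcal L(M(\mathbb{R}_+))$ and $e(A)$ is injective (a *regularizer* for $g$), then $g(A):=e(A)^{-1}(eg)(A)$ with domain $\{u\in X:(eg)(A)u\in\operatorname{ran} e(A)\}$. This operator does not depend on the regularizer $e$ (extended Hille–Phillips calculus). **Theorem.** Let $\mu$ be a positive Laplace transformable Radon measure on $\mathbb{R}_+$ (that is, $\int e^{-ts}\,\mu(ds)<\infty$ for all $t>0$) such that $f(z)=(\mathcal L\mu)(z)=\int_{\mathbb{R}_+}e^{-sz}\,\mu(ds)$, $\operatorname{Re}z>0$, restricts to a potential on $(0,\infty)$ with $\lim_{t\searrow 0}f(t)=\infty$. Let $x,y\in X$ be such that $$\lim_{\alpha\searrow 0}\int_{\mathbb{R}_+} e^{-\alpha s}\,T(s)x\,\mu(ds)=y\quad\text{weakly in }X.$$ Then: (i) $(1/f)(A)$ is defined in the extended Hille–Phillips calculus, $y\in\operatorname{dom}((1/f)(A))$, $x=(1/f)(A)y$, and $\displaystyle\|C_t(A)x\|=O\!\left(\frac1{f(1/t)}\right)$ as $t\to\infty$. (ii) If in addition $t/f(1/t)\to\infty$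 as $t\to\infty$, then $\displaystyle\|C_t(A)x\|=o\!\left(\frac1{f(1/t)}\right)$ as $t\to\infty$. -/

import Mathlib

open MeasureTheory Filter Topology Set
open scoped NNReal ContDiff

noncomputable section

namespace Ergodic

/-! ### Completely monotone functions, Bernstein functions, potentials -/

/-- Completely monotone functions on `(0, ∞)`; values outside `(0, ∞)` are irrelevant. -/
structure IsCompletelyMonotone (f : ℝ → ℝ) : Prop where
  contDiffOn : ContDiffOn ℝ ∞ f (Ioi 0)
  sign : ∀ n : ℕ, ∀ t : ℝ, 0 < t → 0 ≤ (-1) ^ n * iteratedDerivWithin n f (Ioi 0) t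

/-- Bernstein functions on `(0, ∞)`; values outside `(0, ∞)` are irrelevant. -/
structure IsBernstein (g : ℝ → ℝ) : Prop where
  contDiffOn : ContDiffOn ℝ ∞ g (Ioi 0)
  nonneg : ∀ t : ℝ, 0 < t → 0 ≤ g t
  sign : ∀ n : ℕ, 1 ≤ n → ∀ t : ℝ, 0 < t →
    (-1) ^ n * iteratedDerivWithin n g (Ioi 0) t ≤ 0

/-- A potential is a completely monotone function of the form `1 / g`, where `g` is a Bernstein
function that is not identically zero on `(0, ∞)`. -/
def IsPotential (f : ℝ → ℝ) : Prop :=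
  IsCompletelyMonotone f ∧
    ∃ g : ℝ → ℝ, IsBernstein g ∧ (∃ t : ℝ, 0 < t ∧ g t ≠ 0) ∧ ∀ t : ℝ, 0 < t → f t = 1 / g t

/-! ### Laplace transforms of positive measures on `[0, ∞)` -/

/-- A positive measure on `[0, ∞)` is Laplace transformable if `∫ e^{-ts} μ(ds) < ∞` for every
`t > 0`. -/
def LaplaceTransformable (μ : Measure ℝ≥0) : Prop :=
  ∀ t : ℝ, 0 < t → Integrable (fun s : ℝ≥0 => Real.exp (-(t * s))) μ

/-- The Laplace transform of `μ` on the half-line `t > 0`. -/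
def laplaceReal (μ : Measure ℝ≥0) (t : ℝ) : ℝ :=
  ∫ s : ℝ≥0, Real.exp (-(t * s)) ∂μ

/-- The Laplace transform of `μ` on the half-plane `Re z > 0`. -/
def laplace (μ : Measure ℝ≥0) (z : ℂ) : ℂ :=
  ∫ s : ℝ≥0, Complex.exp (-(z * (s : ℝ))) ∂μ

theorem laplace_ofReal (μ : Measure ℝ≥0) (t : ℝ) :
    laplace μ (t : ℂ) = (laplaceReal μ t : ℂ) := by
  unfold laplace laplaceReal
  rw [← integral_complex_ofReal]
  congr 1
  ext s
  push_cast
  rfl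

/-! ### Integration against bounded complex measures on `[0, ∞)`

A complex measure in the sense of Mathlib automatically has finite total variation, and a finite
Borel measure on `[0, ∞)` is automatically Radon, so `ComplexMeasure ℝ≥0` is the space of bounded
complex Radon measures on `[0, ∞)`. -/

/-- The integral `∫ F dν` of a vector-valued function against a complex measure. -/
def cintegral {E : Type*} [NormedAddCommGroup E] [NormedSpace ℂ E]
    (ν : ComplexMeasure ℝ≥0) (F : ℝ≥0 → E) : E :=
  VectorMeasure.integral ν F (ContinuousLinearMap.lsmul ℝ ℂ : ℂ →L[ℝ] E →L[ℝ] E).flip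

/-- The Laplace transform of a bounded complex measure. -/
def claplace (ν : ComplexMeasure ℝ≥0) (z : ℂ) : ℂ :=
  cintegral ν (fun s : ℝ≥0 => Complex.exp (-(z * (s : ℝ))))

/-! ### Bounded `C₀`-semigroups -/

/-- A bounded `C₀`-semigroup of bounded linear operators on `X`. -/
structure BoundedC0Semigroup (X : Type*) [NormedAddCommGroup X] [NormedSpace ℂ X] where
  /-- The operators `T(s)`, `s ≥ 0`. -/
  op : ℝ≥0 → X →L[ℂ] X
  op_zero : op 0 = 1
  op_add : ∀ s t : ℝ≥0, op (s + t) = op s * op t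
  continuous_orbit : ∀ x : X, Continuous fun s : ℝ≥0 => op s x
  bounded : ∃ M : ℝ, ∀ s : ℝ≥0, ‖op s‖ ≤ M

namespace BoundedC0Semigroup

variable {X : Type*} [NormedAddCommGroup X] [NormedSpace ℂ X]

/-- `B` is the generator of the semigroup `T`: `Bx = z` if and only if
`(T(h)x - x) / h → z` as `h ↘ 0`. -/
def IsGenerator (T : BoundedC0Semigroup X) (B : X →ₗ.[ℂ] X) : Prop :=
  ∀ x z : X, (x, z) ∈ B.graph ↔
    Tendsto (fun h : ℝ≥0 => (h : ℝ)⁻¹ • (T.op h x - x)) (𝓝[>] 0) (𝓝 z)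

/-- The Cesàro average `(1/t) ∫_0^t T(s)x ds`. -/
def cesaro (T : BoundedC0Semigroup X) (t : ℝ) (x : X) : X :=
  t⁻¹ • ∫ s in (0 : ℝ)..t, T.op s.toNNReal x

/-- The Hille-Phillips calculus: for `e = Lν` with `ν` a bounded complex measure,
`e(A)x = ∫ T(s)x ν(ds)`, where `-A` is the generator of `T`. -/
def hp (T : BoundedC0Semigroup X) (ν : ComplexMeasure ℝ≥0) (x : X) : X :=
  cintegral ν (fun s : ℝ≥0 => T.op s x)

/-- `e = Lν` is a regularizer for `g`, with `e g = Lρ`: both are Laplace transforms of bounded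
complex measures and `e(A)` is injective. -/
structure IsRegularizer (T : BoundedC0Semigroup X) (g : ℂ → ℂ) (ν ρ : ComplexMeasure ℝ≥0) :
    Prop where
  mul_eq : ∀ z : ℂ, 0 < z.re → claplace ν z * g z = claplace ρ z
  injective : Function.Injective (T.hp ν)

/-- `g(A)` is defined in the extended Hille-Phillips calculus: `g` is holomorphic on `Re z > 0`
and has a regularizer. -/
def IsRegularizable (T : BoundedC0Semigroup X) (g : ℂ → ℂ) : Prop :=
  DifferentiableOn ℂ g {z : ℂ | 0 < z.re} ∧ ∃ ν ρ : ComplexMeasure ℝ≥0, T.IsRegularizer g ν ρ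

/-- `g(A)` is defined in the extended Hille-Phillips calculus, `y` is in its domain, and
`g(A)y = x`. Since `g(A) = e(A)⁻¹ (eg)(A)` with its natural domain and `e(A)` is injective, the last
two assertions say that `(eg)(A)y = e(A)x`. The operator does not depend on the choice of the
regularizer `e`; the equation is required for each of them. -/
def ExtHPEq (T : BoundedC0Semigroup X) (g : ℂ → ℂ) (y x : X) : Prop :=
  T.IsRegularizable g ∧
    ∀ ν ρ : ComplexMeasure ℝ≥0, T.IsRegularizer g ν ρ → T.hp ρ y = T.hp ν x

end BoundedC0Semigroup

end Ergodic

end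

/-! Write `f = 1/g` with `g` Bernstein, and let `C_t(z) = (1 - e^{-zt})/(tz)` be the symbol of the
Cesàro average. Formally `x = g(A)y`, so `C_t(A)x = (C_t g)(A)y`, and everything rests on showing
that `C_t g` is a difference of Laplace transforms of finite measures, with total mass of order
`g(1/t) = 1/f(1/t)`. With `α = 1/t`, one has `C_t g = g(α) C_t + t⁻¹(1 - e^{-zt})·(g(z+α) - g(α))/z
- C_t·(g(z+α) - g(z))`. Both `g(z+α) - g(z)` and `(g(z+α) - g(α))/z` are bounded and completely
monotone; by Bernstein's theorem (deduced here from Hausdorff's moment theorem) they come from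
measures of mass at most `g(α)` and `g(α)/α = t g(α)`. This is `exists_represents_cesaro_mul`.

The formal identity becomes rigorous in `apply_eq_of_represents`: if `G = H f` with `G`, `H`
differences of Laplace transforms of finite measures, then `H(A)y = G(A)x`. After shifting every
symbol by `α > 0`, `f` too is the transform of a finite measure and the calculus is multiplicative.
As `α ↘ 0`, the operators converge in norm and the tilted integrals converge weakly and stay
bounded. With `G = C_t` this gives the rate in (i); applied to real and imaginary parts of arbitrary
regularizing pairs it gives `x = (1/f)(A)y`. A regularizer exists because `g(z)/(1+z)` splits in the
same way.

For (ii), `f(0+) = ∞` forces `y` into the closed span of the ranges of `1 - T(s)`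
(`mem_closure_rangeSpan`). On these ranges `(C_t g)(A)` is `O(1/t)`, which is `o(g(1/t))` when `t
g(1/t) → ∞`; the uniform bound from (i) extends this to the closure (`isLittleO_cesaro_mul`). -/

noncomputable section

namespace Ergodic

/-! ### Complex measures as combinations of positive ones -/

/-- The complex measure `c a` for a finite positive measure `a`. -/
def scaledMeasure (c : ℂ) (a : Measure ℝ≥0) [IsFiniteMeasure a] : ComplexMeasure ℝ≥0 where
  measureOf' s := a.toSignedMeasure s • c
  empty' := by rw [VectorMeasure.empty, zero_smul]
  not_measurable' s hs := by rw [VectorMeasure.not_measurable _ hs, zero_smul]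
  m_iUnion' _ hf hd := (a.toSignedMeasure.m_iUnion hf hd).smul_const c

theorem scaledMeasure_apply (c : ℂ) (a : Measure ℝ≥0) [IsFiniteMeasure a] {s : Set ℝ≥0}
    (hs : MeasurableSet s) : scaledMeasure c a s = a.real s • c := by
  have : scaledMeasure c a s = a.toSignedMeasure s • c := rfl
  rw [this, Measure.toSignedMeasure_apply_measurable hs]

theorem variation_scaledMeasure_le (c : ℂ) (a : Measure ℝ≥0) [IsFiniteMeasure a] :
    (scaledMeasure c a).variation ≤ ‖c‖₊ • a := by
  apply VectorMeasure.variation_le_of_forall_enorm_le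
  intro s hs
  rw [scaledMeasure_apply c a hs, enorm_smul, Measure.smul_apply, mul_comm]
  have : ‖a.real s‖ₑ = a s := by
    rw [Real.enorm_eq_ofReal measureReal_nonneg, Measure.real, ENNReal.ofReal_toReal (by finiteness)]
  rw [this]
  rfl

theorem integrable_scaledMeasure {E : Type*} [NormedAddCommGroup E]
    (c : ℂ) {a : Measure ℝ≥0} [IsFiniteMeasure a] {F : ℝ≥0 → E} (hF : Integrable F a) :
    (scaledMeasure c a).Integrable F :=
  (Integrable.smul_measure_nnreal hF (c := ‖c‖₊)).mono_measure (variation_scaledMeasure_le c a)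

/-- The variation of `c a` is dominated by `|c| a`, so both sides are continuous on `L¹(a)` and
agree once they agree on indicators. -/
theorem cintegral_scaledMeasure {E : Type*} [NormedAddCommGroup E] [NormedSpace ℂ E]
    [CompleteSpace E] (c : ℂ) {a : Measure ℝ≥0} [IsFiniteMeasure a] {F : ℝ≥0 → E}
    (hF : Integrable F a) : cintegral (scaledMeasure c a) F = c • ∫ s, F s ∂a := by
  have hT := dominatedFinMeasAdditive_cbmApplyMeasure (scaledMeasure c a)
    (ContinuousLinearMap.lsmul ℝ ℂ : ℂ →L[ℝ] E →L[ℝ] E).flip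
  have hle : (scaledMeasure c a).variation ≤ (‖c‖₊ : ENNReal) • a :=
    variation_scaledMeasure_le c a
  have hd := hT.of_measure_le_smul ENNReal.coe_ne_top hle (by positivity)
  rw [cintegral, VectorMeasure.integral_eq_setToFun,
    ← setToFun_congr_measure_of_integrable _ ENNReal.coe_ne_top hle hd hT F hF]
  apply hF.induction (P := fun F => setToFun a _ hd F = c • ∫ s, F s ∂a)
  · intro v s hs _
    rw [setToFun_indicator_const hd hs (by finiteness), integral_indicator_const _ hs]
    change (scaledMeasure c a s) • v = _
    rw [scaledMeasure_apply c a hs, smul_assoc, smul_comm]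
  · intro f g _ hf hg h1 h2
    rw [setToFun_add hd hf hg, h1, h2, integral_add' hf hg, smul_add]
  · exact isClosed_eq (continuous_setToFun hd) (continuous_integral.const_smul c)
  · intro f g hfg _ h
    rw [← setToFun_congr_ae hd hfg, h, integral_congr_ae hfg]

/-- A complex measure is a combination of four finite positive measures. -/
theorem exists_eq_scaledMeasure (ν : ComplexMeasure ℝ≥0) :
    ∃ (a b c d : Measure ℝ≥0) (_ : IsFiniteMeasure a) (_ : IsFiniteMeasure b)
      (_ : IsFiniteMeasure c) (_ : IsFiniteMeasure d),
      ν = (scaledMeasure 1 a - scaledMeasure 1 b) +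
        (scaledMeasure Complex.I c - scaledMeasure Complex.I d) := by
  refine ⟨(ComplexMeasure.re ν).toJordanDecomposition.posPart,
    (ComplexMeasure.re ν).toJordanDecomposition.negPart,
    (ComplexMeasure.im ν).toJordanDecomposition.posPart,
    (ComplexMeasure.im ν).toJordanDecomposition.negPart, inferInstance, inferInstance,
    inferInstance, inferInstance, ?_⟩
  ext s hs
  simp only [FunLike.coe_add, FunLike.coe_sub, Pi.add_apply, Pi.sub_apply,
    scaledMeasure_apply _ _ hs]
  have h1 := (ComplexMeasure.re ν).apply_eq_posPart_real_sub_negPart_real hs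
  have h2 := (ComplexMeasure.im ν).apply_eq_posPart_real_sub_negPart_real hs
  change (ν s).re = _ at h1
  change (ν s).im = _ at h2
  apply Complex.ext <;> simp [h1, h2]

theorem cintegral_eq {E : Type*} [NormedAddCommGroup E] [NormedSpace ℂ E]
    [CompleteSpace E] (a b c d : Measure ℝ≥0) [IsFiniteMeasure a] [IsFiniteMeasure b]
    [IsFiniteMeasure c] [IsFiniteMeasure d] {F : ℝ≥0 → E}
    (ha : Integrable F a) (hb : Integrable F b) (hc : Integrable F c) (hd : Integrable F d) :
    cintegral ((scaledMeasure 1 a - scaledMeasure 1 b) +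
        (scaledMeasure Complex.I c - scaledMeasure Complex.I d)) F =
      (∫ s, F s ∂a - ∫ s, F s ∂b) + Complex.I • (∫ s, F s ∂c - ∫ s, F s ∂d) := by
  have i1 := integrable_scaledMeasure 1 ha
  have i2 := integrable_scaledMeasure 1 hb
  have i3 := integrable_scaledMeasure Complex.I hc
  have i4 := integrable_scaledMeasure Complex.I hd
  have e1 := cintegral_scaledMeasure 1 ha
  have e2 := cintegral_scaledMeasure 1 hb
  have e3 := cintegral_scaledMeasure Complex.I hc
  have e4 := cintegral_scaledMeasure Complex.I hd
  unfold cintegral at *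
  rw [VectorMeasure.integral_add_vectorMeasure (i1.sub_vectorMeasure i2)
    (i3.sub_vectorMeasure i4), VectorMeasure.integral_sub_vectorMeasure i1 i2,
    VectorMeasure.integral_sub_vectorMeasure i3 i4, e1, e2, e3, e4]
  simp [smul_sub]

/-! ### Uniqueness of the Laplace transform -/

theorem integrable_exp_neg (a : Measure ℝ≥0) [IsFiniteMeasure a] {t : ℝ} (ht : 0 ≤ t) :
    Integrable (fun s : ℝ≥0 => Real.exp (-(t * s))) a := by
  refine Integrable.of_bound (C := 1) (by fun_prop) (ae_of_all _ fun s => ?_)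
  rw [Real.norm_eq_abs, abs_of_pos (Real.exp_pos _)]
  exact Real.exp_le_one_iff.2 (by have := s.2; have : 0 ≤ t * s := by positivity
                                  linarith)

/-- The function `s ↦ e^{-s}` as a bounded continuous function. -/
def expNeg : BoundedContinuousFunction ℝ≥0 ℝ :=
  BoundedContinuousFunction.ofNormedAddCommGroup (fun s : ℝ≥0 => Real.exp (-(s : ℝ)))
    (by fun_prop) 1 (fun s => by
      rw [Real.norm_eq_abs, abs_of_pos (Real.exp_pos _)]
      exact Real.exp_le_one_iff.2 (by simp))

theorem expNeg_pow_apply (n : ℕ) (s : ℝ≥0) : (expNeg ^ n) s = Real.exp (-(n * s)) := by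
  rw [BoundedContinuousFunction.pow_apply]
  change Real.exp (-(s : ℝ)) ^ n = _
  rw [← Real.exp_nat_mul]; ring_nf

theorem tendsto_laplaceReal_zero (a : Measure ℝ≥0) [IsFiniteMeasure a] :
    Tendsto (laplaceReal a) (𝓝[>] 0) (𝓝 (a.real univ)) := by
  have : a.real univ = ∫ s : ℝ≥0, (1 : ℝ) ∂a := by simp
  rw [this]
  refine tendsto_integral_filter_of_dominated_convergence (fun _ => 1) ?_ ?_ (integrable_const _) ?_
  · exact Eventually.of_forall fun t => by fun_prop
  · filter_upwards [self_mem_nhdsWithin] with t ht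
    refine ae_of_all _ fun s => ?_
    rw [Real.norm_eq_abs, abs_of_pos (Real.exp_pos _)]
    exact Real.exp_le_one_iff.2 (by have : 0 ≤ t * s := mul_nonneg (le_of_lt ht) s.2
                                    linarith)
  · refine ae_of_all _ fun s => ?_
    have : Continuous fun t : ℝ => Real.exp (-(t * s)) := by fun_prop
    have h := this.tendsto 0
    simp only [zero_mul, neg_zero, Real.exp_zero] at h
    exact h.mono_left nhdsWithin_le_nhds

/-- Finite measures are determined by the exponential moments `∫ e^{-ns}`, `n ≥ 0`. -/
theorem measure_ext_of_exp_moments {a b : Measure ℝ≥0} [IsFiniteMeasure a] [IsFiniteMeasure b]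
    (h : ∀ n : ℕ, laplaceReal a n = laplaceReal b n) : a = b := by
  -- Polynomials in `e^{-s}` form a point-separating algebra, and their integrals are combinations
  -- of the given moments.
  let A : StarSubalgebra ℝ (BoundedContinuousFunction ℝ≥0 ℝ) :=
    { Algebra.adjoin ℝ {expNeg} with
      star_mem' := fun {x} hx => by
        have : star x = x := by ext; simp
        rwa [this] }
  refine ext_of_forall_mem_subalgebra_integral_eq_of_pseudoEMetric_complete_countable (𝕜 := ℝ)
    (A := A) ?_ ?_
  · intro x y hxy
    refine ⟨_, ⟨_, ⟨expNeg, Algebra.self_mem_adjoin_singleton ℝ expNeg, rfl⟩, rfl⟩, ?_⟩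
    change Real.exp (-(x : ℝ)) ≠ Real.exp (-(y : ℝ))
    simpa using hxy
  · intro g hg
    have hg' : g ∈ Algebra.adjoin ℝ {expNeg} := hg
    rw [Algebra.adjoin_singleton_eq_range_aeval] at hg'
    obtain ⟨p, rfl⟩ := hg'
    change ∫ x, (Polynomial.aeval expNeg p) x ∂a = ∫ x, (Polynomial.aeval expNeg p) x ∂b
    clear hg
    induction p using Polynomial.induction_on' with
    | add p q hp hq =>
      simp only [map_add, BoundedContinuousFunction.add_apply]
      have e : ∀ (c : Measure ℝ≥0) [IsFiniteMeasure c],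
          ∫ x, (Polynomial.aeval expNeg p) x + (Polynomial.aeval expNeg q) x ∂c =
          ∫ x, (Polynomial.aeval expNeg p) x ∂c + ∫ x, (Polynomial.aeval expNeg q) x ∂c :=
        fun c _ => integral_add (BoundedContinuousFunction.integrable c _)
          (BoundedContinuousFunction.integrable c _)
      rw [e a, e b, hp, hq]
    | monomial n c =>
      simp only [Polynomial.aeval_monomial, BoundedContinuousFunction.mul_apply, expNeg_pow_apply]
      have := h n
      unfold laplaceReal at this
      have e : ∀ x, (algebraMap ℝ (BoundedContinuousFunction ℝ≥0 ℝ) c) x = c := fun _ => rfl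
      simp only [e, integral_const_mul, this]

/-- Tilting by `e^{-s}` shifts the index by one, so the total mass need not be known; the density is
invertible and can be removed afterwards. -/
theorem measure_ext_of_laplaceReal_nat {a b : Measure ℝ≥0} [IsFiniteMeasure a] [IsFiniteMeasure b]
    (h : ∀ n : ℕ, 1 ≤ n → laplaceReal a n = laplaceReal b n) : a = b := by
  have key : ∀ (c : Measure ℝ≥0) [IsFiniteMeasure c] (t : ℝ),
      laplaceReal (c.withDensity fun s => ENNReal.ofReal (Real.exp (-(s : ℝ)))) t =
        laplaceReal c (t + 1) := by
    intro c _ t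
    unfold laplaceReal
    rw [integral_withDensity_eq_integral_toReal_smul (by fun_prop) (by simp)]
    refine integral_congr_ae (ae_of_all _ fun s => ?_)
    simp only [ENNReal.toReal_ofReal (Real.exp_pos _).le, smul_eq_mul, ← Real.exp_add]
    ring_nf
  have fin : ∀ (c : Measure ℝ≥0) [IsFiniteMeasure c],
      IsFiniteMeasure (c.withDensity fun s => ENNReal.ofReal (Real.exp (-(s : ℝ)))) := by
    intro c _
    have := integrable_exp_neg c zero_le_one
    simp only [one_mul] at this
    exact isFiniteMeasure_withDensity_ofReal this.2
  have := fin a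
  have := fin b
  have hab := measure_ext_of_exp_moments (a := a.withDensity _) (b := b.withDensity _) fun n => by
    rw [key a, key b]
    exact_mod_cast h (n + 1) (by simp)
  have inv : ∀ c : Measure ℝ≥0,
      (c.withDensity fun s => ENNReal.ofReal (Real.exp (-(s : ℝ)))).withDensity
      (fun s => ENNReal.ofReal (Real.exp (-(s : ℝ))))⁻¹ = c := fun c =>
    withDensity_inv_same (by fun_prop) (ae_of_all _ fun s => by simp [Real.exp_pos])
      (ae_of_all _ fun s => by simp)
  rw [← inv a, hab, inv b]

/-! ### The Hausdorff moment problem -/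

/-- The shift on real sequences. -/
def seqShift : Module.End ℝ (ℕ → ℝ) where
  toFun a n := a (n + 1)
  map_add' _ _ := rfl
  map_smul' _ _ := rfl

/-- The backward difference `a n - a (n + 1)` on real sequences. -/
def seqDiff : Module.End ℝ (ℕ → ℝ) := 1 - seqShift

theorem seqDiff_apply (a : ℕ → ℝ) (n : ℕ) : seqDiff a n = a n - a (n + 1) := rfl

theorem seqShift_pow_apply (l : ℕ) (a : ℕ → ℝ) (n : ℕ) : (seqShift ^ l) a n = a (n + l) := by
  induction l generalizing a with
  | zero => rfl
  | succ l ih =>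
    rw [pow_succ, Module.End.mul_apply, ih]
    change a (n + l + 1) = _
    rw [add_assoc]

theorem commute_seqShift_seqDiff : Commute seqShift seqDiff :=
  (Commute.one_right _).sub_right (Commute.refl _)

/-- This is the binomial expansion of `(S + Δ)^n = 1`, where the shift `S` and the backward
difference `Δ = 1 - S` commute. -/
theorem sum_choose_seqDiff (a : ℕ → ℝ) (n j : ℕ) :
    ∑ l ∈ Finset.range (n + 1), (n.choose l : ℝ) * (seqDiff ^ (n - l)) a (j + l) = a j := by
  have h := commute_seqShift_seqDiff.add_pow n
  have h1 : seqShift + seqDiff = 1 := by simp [seqDiff]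
  rw [h1, one_pow] at h
  have h2 := congrFun (congrArg (fun L : Module.End ℝ (ℕ → ℝ) => L a) h) j
  simp only [Module.End.one_apply] at h2
  rw [h2, LinearMap.sum_apply, Finset.sum_apply]
  refine Finset.sum_congr rfl fun l _ => ?_
  rw [← Nat.cast_comm, ← nsmul_eq_mul, ← nsmul_eq_mul, LinearMap.smul_apply, Pi.smul_apply,
    Module.End.mul_apply, seqShift_pow_apply]

/-- The weights of the Bernstein approximation of a moment sequence. -/
def momentWeight (a : ℕ → ℝ) (N i : ℕ) : ℝ := N.choose i * (seqDiff ^ (N - i)) a i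

/-- Factorial moments of the Bernstein weights are exact because `C(N,i)·(i)_j/(N)_j = C(N-j, i-j)`,
which reduces the sum to `sum_choose_seqDiff`. -/
theorem sum_momentWeight_descFactorial (a : ℕ → ℝ) {N j : ℕ} (hj : j ≤ N) :
    ∑ i ∈ Finset.range (N + 1), momentWeight a N i * (i.descFactorial j / N.descFactorial j) =
      a j := by
  rw [← sum_choose_seqDiff a (N - j) j]
  have hN : N + 1 = j + (N - j + 1) := by omega
  rw [hN, Finset.sum_range_add, Finset.sum_eq_zero, zero_add]
  · refine Finset.sum_congr rfl fun l hl => ?_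
    have hl' : l ≤ N - j := by simpa [Nat.lt_succ_iff] using hl
    rw [momentWeight]
    have e1 : N - (j + l) = N - j - l := by omega
    have e2 : (N.choose (j + l) : ℝ) * ((j + l).descFactorial j / N.descFactorial j) =
        (N - j).choose l := by
      have hpos : (N.descFactorial j : ℝ) ≠ 0 := by
        exact_mod_cast (Nat.pos_iff_ne_zero.1 (Nat.descFactorial_pos.2 hj))
      rw [← mul_div_assoc, div_eq_iff hpos]
      norm_cast
      have h1 := Nat.choose_mul (n := N) (k := j + l) (s := j) (by omega)
      rw [Nat.descFactorial_eq_factorial_mul_choose, Nat.descFactorial_eq_factorial_mul_choose]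
      have e3 : j + l - j = l := by omega
      rw [e3] at h1
      calc _ = j.factorial * (N.choose (j + l) * (j + l).choose j) := by ring
        _ = _ := by rw [h1]; ring
    rw [e1, ← e2]; ring
  · intro i hi
    rw [Nat.descFactorial_eq_zero_iff_lt.2 (by simpa using hi)]
    simp

theorem descFactorial_ratio_le_one {N i : ℕ} (h : i ≤ N) (j : ℕ) :
    (i.descFactorial j : ℝ) / N.descFactorial j ≤ 1 :=
  div_le_one_of_le₀ (by exact_mod_cast Nat.descFactorial_le j h) (by positivity)

/-- The ratio is a product of factors `(i-k)/(N-k)`, each within `k/(N-k)` of `i/N`; all lie in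
`[0,1]`, so the errors add up. -/
theorem abs_descFactorial_ratio_sub_le {N i j : ℕ} (h : i ≤ N) (hj : j < N) :
    |(i.descFactorial j : ℝ) / N.descFactorial j - ((i : ℝ) / N) ^ j| ≤ j * j / (N - j : ℝ) := by
  induction j with
  | zero => simp
  | succ j ih =>
    have ih := ih (by omega)
    have hN : (0 : ℝ) < N := by exact_mod_cast (by omega : 0 < N)
    have hjN : (0 : ℝ) < N - j - 1 := by
      have : ((j + 1 : ℕ) : ℝ) < N := by exact_mod_cast hj
      push_cast at this; linarith
    have hx0 : (0 : ℝ) ≤ (i : ℝ) / N := by positivity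
    have hx1 : (i : ℝ) / N ≤ 1 := div_le_one_of_le₀ (by exact_mod_cast h) hN.le
    have hsub : ((N - j : ℕ) : ℝ) = N - j := by rw [Nat.cast_sub (by omega)]
    have e : (i.descFactorial (j + 1) : ℝ) / N.descFactorial (j + 1) =
        (((i - j : ℕ) : ℝ) / (N - j)) * ((i.descFactorial j : ℝ) / N.descFactorial j) := by
      rw [Nat.descFactorial_succ, Nat.descFactorial_succ, Nat.cast_mul, Nat.cast_mul, hsub,
        mul_div_mul_comm]
    set d := (i.descFactorial j : ℝ) / N.descFactorial j
    have hd0 : 0 ≤ d := by positivity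
    have hd1 : d ≤ 1 := descFactorial_ratio_le_one h j
    have hr : |((i - j : ℕ) : ℝ) / (N - j) - (i : ℝ) / N| ≤ j / (N - j) := by
      rcases le_total j i with hji | hij
      · rw [Nat.cast_sub hji]
        have hi' : (i : ℝ) ≤ N := by exact_mod_cast h
        have : ((i : ℝ) - j) / (N - j) - (i : ℝ) / N = -(j / (N - j) * (1 - (i : ℝ) / N)) := by
          have : (N : ℝ) - j ≠ 0 := by linarith
          field_simp; ring
        rw [this, abs_neg, abs_of_nonneg (mul_nonneg (div_nonneg (by positivity) (by linarith))
          (by linarith))]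
        exact mul_le_of_le_one_right (div_nonneg (by positivity) (by linarith)) (by linarith)
      -- Here the truncated difference `i - j` is `0`, and the error is just `i/N ≤ j/(N-j)`.
      · rw [Nat.sub_eq_zero_of_le hij]
        simp only [Nat.cast_zero, zero_div, zero_sub, abs_neg, abs_of_nonneg hx0]
        have : (i : ℝ) ≤ j := by exact_mod_cast hij
        gcongr
        · linarith
        · linarith [(Nat.cast_nonneg j : (0 : ℝ) ≤ j)]
    have split : (i.descFactorial (j + 1) : ℝ) / N.descFactorial (j + 1) - ((i : ℝ) / N) ^ (j + 1) =
        (((i - j : ℕ) : ℝ) / (N - j) - (i : ℝ) / N) * d + (i : ℝ) / N * (d - ((i : ℝ) / N) ^ j) := by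
      rw [e]; ring
    rw [split]
    calc _ ≤ |((i - j : ℕ) : ℝ) / (N - j) - (i : ℝ) / N| * 1 +
          1 * |d - ((i : ℝ) / N) ^ j| := by
          refine (abs_add_le _ _).trans ?_
          rw [abs_mul, abs_mul, abs_of_nonneg hd0, abs_of_nonneg hx0]
          gcongr
      _ ≤ j / (N - j) + j * j / (N - j) := by rw [mul_one, one_mul]; gcongr
      _ = (j * (j + 1)) / (N - j) := by ring
      _ ≤ _ := by
          push_cast
          apply div_le_div₀ (by positivity) _ (by linarith) (by linarith)
          gcongr
          linarith

/-- The discrete measures approximating the solution of the moment problem. -/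
def momentApprox (a : ℕ → ℝ) (N : ℕ) : Measure unitInterval :=
  ∑ i ∈ Finset.range (N + 1), ENNReal.ofReal (momentWeight a N i) •
    Measure.dirac (projIcc (0 : ℝ) 1 zero_le_one ((i : ℝ) / N))

theorem integral_momentApprox {a : ℕ → ℝ} (ha : ∀ m n, 0 ≤ (seqDiff ^ m) a n) (N : ℕ)
    (F : unitInterval → ℝ) : ∫ u, F u ∂(momentApprox a N) =
      ∑ i ∈ Finset.range (N + 1), momentWeight a N i *
        F (projIcc (0 : ℝ) 1 zero_le_one ((i : ℝ) / N)) := by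
  rw [momentApprox, integral_finsetSum_measure]
  · refine Finset.sum_congr rfl fun i _ => ?_
    rw [integral_smul_measure, integral_dirac, ENNReal.toReal_ofReal, smul_eq_mul]
    exact mul_nonneg (by positivity) (ha _ _)
  · intro i _
    exact (integrable_dirac (by simp)).smul_measure (by simp)

instance (a : ℕ → ℝ) (N : ℕ) : IsFiniteMeasure (momentApprox a N) := by
  refine ⟨?_⟩
  simp [momentApprox, ENNReal.sum_lt_top]

theorem sum_momentWeight (a : ℕ → ℝ) (N : ℕ) :
    ∑ i ∈ Finset.range (N + 1), momentWeight a N i = a 0 := by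
  simpa using sum_momentWeight_descFactorial a (N.zero_le)

theorem tendsto_moment {a : ℕ → ℝ} (ha : ∀ m n, 0 ≤ (seqDiff ^ m) a n) (j : ℕ) :
    Tendsto (fun N => ∫ u, (u : ℝ) ^ j ∂(momentApprox a N)) atTop (𝓝 (a j)) := by
  have hw : ∀ N i, 0 ≤ momentWeight a N i := fun N i => mul_nonneg (by positivity) (ha _ _)
  rw [tendsto_iff_norm_sub_tendsto_zero]
  have hlim : Tendsto (fun N : ℕ => a 0 * (j * j / ((N : ℝ) - j))) atTop (𝓝 0) := by
    have : Tendsto (fun N : ℕ => (N : ℝ) - j) atTop atTop :=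
      tendsto_atTop_add_const_right _ _ tendsto_natCast_atTop_atTop
    simpa using (this.const_div_atTop ((j : ℝ) * j)).const_mul (a 0)
  refine squeeze_zero' (Eventually.of_forall fun _ => norm_nonneg _) ?_ hlim
  filter_upwards [eventually_gt_atTop j] with N hN
  rw [integral_momentApprox ha, ← sum_momentWeight_descFactorial a hN.le, ← Finset.sum_sub_distrib,
    ← sum_momentWeight a N, Finset.sum_mul]
  refine (norm_sum_le _ _).trans (Finset.sum_le_sum fun i hi => ?_)
  have hi' : i ≤ N := by simpa [Nat.lt_succ_iff] using hi
  have hN0 : (0 : ℝ) < N := by exact_mod_cast (by omega : 0 < N)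
  have hmem : (i : ℝ) / N ∈ Icc (0 : ℝ) 1 :=
    ⟨by positivity, div_le_one_of_le₀ (by exact_mod_cast hi') hN0.le⟩
  rw [projIcc_of_mem zero_le_one hmem, ← mul_sub, norm_mul, Real.norm_of_nonneg (hw N i),
    Real.norm_eq_abs, abs_sub_comm]
  exact mul_le_mul_of_nonneg_left (abs_descFactorial_ratio_sub_le hi' hN) (hw N i)

/-- **Hausdorff's theorem**: a completely monotone sequence is a moment sequence on `[0, 1]`. -/
theorem exists_measure_moment {a : ℕ → ℝ} (ha : ∀ m n, 0 ≤ (seqDiff ^ m) a n) :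
    ∃ m : Measure unitInterval, IsFiniteMeasure m ∧ ∀ j : ℕ, ∫ u, (u : ℝ) ^ j ∂m = a j := by
  let f : ℕ → FiniteMeasure unitInterval := fun N => ⟨momentApprox a N, inferInstance⟩
  have hcpt := isCompact_setOfPred_finiteMeasure_eq_of_compactSpace unitInterval (a 0).toNNReal
  have hmass : ∀ N, (f N).mass = (a 0).toNNReal := by
    intro N
    have h := integral_momentApprox ha N (fun _ => 1)
    simp only [integral_const, smul_eq_mul, mul_one, sum_momentWeight] at h
    rw [← h]
    apply NNReal.coe_injective
    rw [Real.coe_toNNReal _ measureReal_nonneg]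
    rfl
  -- All approximants have mass `a 0`, hence lie in a compact set; a free ultrafilter selects a
  -- limit without extracting a subsequence.
  obtain ⟨m, -, hm⟩ := hcpt.ultrafilter_le_nhds ((Filter.hyperfilter ℕ).map f) (by
    rw [Filter.le_principal_iff]
    exact Filter.mem_map.2 (Filter.univ_mem' hmass))
  refine ⟨m, inferInstance, fun j => ?_⟩
  have hm' : Tendsto f (Filter.hyperfilter ℕ) (𝓝 m) := hm
  rw [FiniteMeasure.tendsto_iff_forall_integral_tendsto] at hm'
  have h1 := hm' (BoundedContinuousFunction.mkOfCompact
    ⟨fun u : unitInterval => (u : ℝ) ^ j, by fun_prop⟩)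
  have h2 := (tendsto_moment ha j).mono_left Nat.hyperfilter_le_atTop
  exact tendsto_nhds_unique h1 h2

/-! ### Bernstein's theorem for bounded completely monotone functions -/

/-- `F n = (-1)ⁿ f⁽ⁿ⁾` on `(0, ∞)` for a completely monotone function `f = F 0`. -/
def IsCMFamily (F : ℕ → ℝ → ℝ) : Prop :=
  ∀ n t, 0 < t → 0 ≤ F n t ∧ HasDerivAt (F n) (-F (n + 1) t) t

theorem IsCMFamily.antitoneOn {F : ℕ → ℝ → ℝ} (hF : IsCMFamily F) (n : ℕ) :
    AntitoneOn (F n) (Ioi 0) := by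
  refine antitoneOn_of_deriv_nonpos (convex_Ioi 0)
    (fun t ht => (hF n t ht).2.continuousAt.continuousWithinAt) ?_ ?_
  · intro t ht
    rw [interior_Ioi] at ht
    exact (hF n t ht).2.differentiableAt.differentiableWithinAt
  · intro t ht
    rw [interior_Ioi] at ht
    rw [(hF n t ht).2.deriv]
    linarith [(hF (n + 1) t ht).1]

theorem IsCMFamily.continuousOn {F : ℕ → ℝ → ℝ} (hF : IsCMFamily F) (n : ℕ) :
    ContinuousOn (F n) (Ioi 0) :=
  fun t ht => (hF n t ht).2.continuousAt.continuousWithinAt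

theorem IsCMFamily.comp_add {F : ℕ → ℝ → ℝ} (hF : IsCMFamily F) {h : ℝ} (hh : 0 ≤ h) :
    IsCMFamily fun n t => F n (t + h) := fun n t ht =>
  ⟨(hF n (t + h) (by linarith)).1, (hF n (t + h) (by linarith)).2.comp_add_const t h⟩

theorem IsCMFamily.sub_comp_add {F : ℕ → ℝ → ℝ} (hF : IsCMFamily F) {h : ℝ} (hh : 0 ≤ h) :
    IsCMFamily fun n t => F n t - F n (t + h) := fun n t ht =>
  ⟨sub_nonneg.2 (hF.antitoneOn n ht (show 0 < t + h by linarith) (by linarith)), by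
    have := (hF n t ht).2.sub (hF.comp_add hh n t ht).2
    refine this.congr_deriv ?_
    simp only
    ring⟩

/-- The sequence `C, f h, f (2h), …`. -/
def boundedSeq (C : ℝ) (f : ℝ → ℝ) (h : ℝ) : ℕ → ℝ
  | 0 => C
  | n + 1 => f ((n + 1) * h)

theorem seqDiff_boundedSeq (C : ℝ) (f : ℝ → ℝ) (h : ℝ) :
    seqDiff (boundedSeq C f h) = boundedSeq (C - f h) (fun t => f t - f (t + h)) h := by
  ext n
  rw [seqDiff_apply]
  cases n with
  | zero => simp [boundedSeq]
  | succ n => simp only [boundedSeq]; push_cast; ring_nf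

/-- The upper bound `C` stands in for `f(0+)` as the zeroth term. Differencing turns `(C, f)` into
`(C - f h, f - f(· + h))`, a pair of the same kind, which is why `F` and `C` vary in the induction.
-/
theorem IsCMFamily.seqDiff_pow_nonneg {h : ℝ} (hh : 0 < h) (m : ℕ) :
    ∀ {F : ℕ → ℝ → ℝ} {C : ℝ}, IsCMFamily F → (∀ t, 0 < t → F 0 t ≤ C) →
      ∀ n, 0 ≤ (seqDiff ^ m) (boundedSeq C (F 0) h) n := by
  induction m with
  | zero =>
    intro F C hF hC n
    rw [pow_zero, Module.End.one_apply]
    cases n with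
    | zero => exact (hF 0 1 one_pos).1.trans (hC 1 one_pos)
    | succ n => exact (hF 0 _ (by positivity)).1
  | succ m ih =>
    intro F C hF hC n
    rw [pow_succ, Module.End.mul_apply, seqDiff_boundedSeq]
    have hG := hF.sub_comp_add hh.le
    refine ih (F := fun n t => F n t - F n (t + h)) hG (fun t ht => ?_) n
    -- For `s < t`, monotonicity gives `f t - f (t+h) ≤ f s - f (s+h) ≤ C - f (s+h)`; then `s ↘ 0`.
    have hlim : Tendsto (fun s => C - F 0 (s + h)) (𝓝[>] 0) (𝓝 (C - F 0 h)) := by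
      have h1 : ContinuousAt (F 0) (0 + h) := (hF 0 (0 + h) (by linarith)).2.continuousAt
      have h2 : ContinuousAt (fun s => F 0 (s + h)) 0 :=
        ContinuousAt.comp (f := fun s => s + h) h1 (by fun_prop)
      have h3 := (h2.tendsto.const_sub C).mono_left (nhdsWithin_le_nhds (s := Ioi 0))
      simpa using h3
    refine ge_of_tendsto hlim ?_
    filter_upwards [Ioo_mem_nhdsGT ht] with s hs
    have h1 := hG.antitoneOn 0 hs.1 ht hs.2.le
    have h2 := hC s hs.1
    simp only at h1
    linarith

/-- The exponential moments of a bounded completely monotone function at the multiples of `h`. -/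
theorem IsCMFamily.exists_measure_nat {F : ℕ → ℝ → ℝ} (hF : IsCMFamily F) {C : ℝ}
    (hC : ∀ t, 0 < t → F 0 t ≤ C) {h : ℝ} (hh : 0 < h) :
    ∃ m : Measure ℝ≥0, IsFiniteMeasure m ∧
      ∀ n : ℕ, 1 ≤ n → laplaceReal m n = F 0 (n * h) := by
  obtain ⟨m, hm, hmom⟩ := exists_measure_moment fun k n => hF.seqDiff_pow_nonneg hh k hC n
  have hmeas : Measurable fun u : unitInterval => (-Real.log u).toNNReal := by fun_prop
  -- Substitute `u = e^{-s}`. An atom at `u = 0` would sit at `s = ∞`; it is discarded, and moments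
  -- of order `n ≥ 1` do not see it.
  refine ⟨(m.restrict {0}ᶜ).map fun u : unitInterval => (-Real.log u).toNNReal, inferInstance,
    fun n hn => ?_⟩
  unfold laplaceReal
  rw [integral_map hmeas.aemeasurable (by fun_prop)]
  have h1 : ∫ u in ({0}ᶜ : Set unitInterval), Real.exp (-((n : ℝ) * (-Real.log u).toNNReal)) ∂m =
      ∫ u in ({0}ᶜ : Set unitInterval), (u : ℝ) ^ n ∂m := by
    refine setIntegral_congr_fun (measurableSet_singleton _).compl fun u hu => ?_
    have hu0 : 0 < (u : ℝ) := by
      rcases u.2.1.lt_or_eq with h | h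
      · exact h
      · exact absurd (Subtype.ext h.symm) hu
    have hlog : 0 ≤ -Real.log u := by linarith [Real.log_nonpos hu0.le u.2.2]
    rw [Real.coe_toNNReal _ hlog, show -((n : ℝ) * -Real.log u) = n * Real.log u by ring,
      Real.exp_nat_mul, Real.exp_log hu0]
  rw [h1, setIntegral_eq_integral_of_forall_compl_eq_zero, hmom]
  · obtain ⟨k, rfl⟩ := Nat.exists_eq_add_of_le' hn
    simp [boundedSeq]
  · intro u hu
    have : u = 0 := by simpa using hu
    rw [this]
    simpa using (by omega : n ≠ 0)

theorem continuousOn_laplaceReal (m : Measure ℝ≥0) [IsFiniteMeasure m] :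
    ContinuousOn (laplaceReal m) (Ioi 0) := by
  intro t ht
  refine ContinuousAt.continuousWithinAt ?_
  refine continuousAt_of_dominated (bound := fun _ => 1) ?_ ?_ (integrable_const _) ?_
  · exact Eventually.of_forall fun t => by fun_prop
  · filter_upwards [Ioi_mem_nhds ht] with t ht
    refine ae_of_all _ fun s => ?_
    rw [Real.norm_eq_abs, abs_of_pos (Real.exp_pos _)]
    exact Real.exp_le_one_iff.2 (by have : 0 ≤ t * s := mul_nonneg (le_of_lt ht) s.2
                                    linarith)
  · exact ae_of_all _ fun s => by fun_prop

/-- **Bernstein's theorem** for bounded completely monotone functions. -/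
theorem IsCMFamily.exists_measure {F : ℕ → ℝ → ℝ} (hF : IsCMFamily F) {C : ℝ}
    (hC : ∀ t, 0 < t → F 0 t ≤ C) :
    ∃ m : Measure ℝ≥0, IsFiniteMeasure m ∧ m.real univ ≤ C ∧
      ∀ t, 0 < t → laplaceReal m t = F 0 t := by
  obtain ⟨m, hm, hmom⟩ := hF.exists_measure_nat hC one_pos
  have hrat : ∀ n k : ℕ, 1 ≤ n → 1 ≤ k → laplaceReal m (n / k) = F 0 (n / k) := by
    intro n k hn hk
    have hk0 : (0 : ℝ) < k := by exact_mod_cast hk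
    -- The measure for step `1/k`, dilated by `k`, agrees with `m` at the integers, hence equals
    -- `m`. So `m` has the right transform at all positive rationals, and continuity does the rest.
    obtain ⟨m', hm', hmom'⟩ := hF.exists_measure_nat hC (h := 1 / k) (by positivity)
    have hmap : ∀ t : ℝ, laplaceReal (m'.map fun s => (k : ℝ≥0) * s) t = laplaceReal m' (k * t) := by
      intro t
      unfold laplaceReal
      rw [integral_map (by fun_prop) (by fun_prop)]
      refine integral_congr_ae (ae_of_all _ fun s => ?_)
      simp only [NNReal.coe_mul, NNReal.coe_natCast]
      ring_nf
    have heq : m'.map (fun s => (k : ℝ≥0) * s) = m := by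
      refine measure_ext_of_laplaceReal_nat fun j hj => ?_
      rw [hmap, hmom j hj]
      have := hmom' (k * j) (Nat.mul_pos hk hj)
      push_cast at this
      rw [this]
      congr 1
      field_simp
    rw [← heq, hmap, mul_div_cancel₀ _ hk0.ne', hmom' n hn, mul_one_div]
  have hall : ∀ t, 0 < t → laplaceReal m t = F 0 t := by
    intro t ht
    have hlim : Tendsto (fun k : ℕ => (⌈t * k⌉₊ : ℝ) / (k : ℝ)) atTop (𝓝 t) :=
      (tendsto_nat_ceil_mul_div_atTop ht.le).comp tendsto_natCast_atTop_atTop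
    have h1 := ((continuousOn_laplaceReal m).continuousAt (Ioi_mem_nhds ht)).tendsto.comp hlim
    have h2 := (hF 0 t ht).2.continuousAt.tendsto.comp hlim
    refine tendsto_nhds_unique h1 (h2.congr' ?_)
    filter_upwards [eventually_ge_atTop 1] with k hk
    refine (hrat _ _ (Nat.one_le_ceil_iff.2 ?_) hk).symm
    have : (0 : ℝ) < k := by exact_mod_cast hk
    positivity
  refine ⟨m, hm, ?_, hall⟩
  refine le_of_tendsto (tendsto_laplaceReal_zero m) ?_
  filter_upwards [self_mem_nhdsWithin] with t ht
  rw [hall t ht]; exact hC t ht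

/-! ### Measures associated with a Bernstein function -/

/-- `g` is nonnegative on `(0, ∞)` and `D 0` is its derivative there, where `D` is the family of a
completely monotone function. -/
structure IsBernsteinPair (g : ℝ → ℝ) (D : ℕ → ℝ → ℝ) : Prop where
  cm : IsCMFamily D
  hasDerivAt : ∀ t, 0 < t → HasDerivAt g (D 0 t) t
  nonneg : ∀ t, 0 < t → 0 ≤ g t

theorem IsBernstein.isBernsteinPair {g : ℝ → ℝ} (hg : IsBernstein g) :
    IsBernsteinPair g fun n t => (-1) ^ n * iteratedDerivWithin (n + 1) g (Ioi 0) t := by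
  have hd : ∀ n t, 0 < t → HasDerivAt (iteratedDerivWithin n g (Ioi 0))
      (iteratedDerivWithin (n + 1) g (Ioi 0) t) t := by
    intro n t ht
    have h1 : DifferentiableOn ℝ (iteratedDerivWithin n g (Ioi 0)) (Ioi 0) :=
      hg.contDiffOn.differentiableOn_iteratedDerivWithin (by exact_mod_cast WithTop.coe_lt_top _)
        (uniqueDiffOn_Ioi 0)
    rw [iteratedDerivWithin_succ]
    exact (h1 t ht).hasDerivWithinAt.hasDerivAt (Ioi_mem_nhds ht)
  refine ⟨fun n t ht => ⟨?_, ?_⟩, fun t ht => ?_, hg.nonneg⟩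
  · have := hg.sign (n + 1) (by omega) t ht
    rw [pow_succ] at this
    linarith
  · refine ((hd (n + 1) t ht).const_mul ((-1) ^ n)).congr_deriv ?_
    rw [pow_succ]; ring
  · have := hd 0 t ht
    rw [iteratedDerivWithin_zero] at this
    simpa using this

theorem IsBernsteinPair.monotoneOn {g : ℝ → ℝ} {D : ℕ → ℝ → ℝ} (h : IsBernsteinPair g D) :
    MonotoneOn g (Ioi 0) := by
  refine monotoneOn_of_deriv_nonneg (convex_Ioi 0)
    (fun t ht => (h.hasDerivAt t ht).continuousAt.continuousWithinAt) ?_ ?_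
  · intro t ht
    rw [interior_Ioi] at ht
    exact (h.hasDerivAt t ht).differentiableAt.differentiableWithinAt
  · intro t ht
    rw [interior_Ioi] at ht
    rw [(h.hasDerivAt t ht).deriv]
    exact (h.cm 0 t ht).1

theorem IsPotential.exists_isBernsteinPair {f : ℝ → ℝ} (hf : IsPotential f)
    (hf0 : Tendsto f (𝓝[>] 0) atTop) :
    ∃ g D, IsBernsteinPair g D ∧ ∀ t, 0 < t → 0 < g t ∧ f t = 1 / g t := by
  obtain ⟨-, g, hg, -, hfg⟩ := hf
  refine ⟨g, _, hg.isBernsteinPair, fun t ht => ⟨?_, hfg t ht⟩⟩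
  -- Since `1 / 0 = 0`, the equation `f = 1 / g` alone does not exclude zeros of `g`. But `f > 0`
  -- near `0` makes `g` positive there, and `g` is increasing.
  obtain ⟨s, hs, hs'⟩ := ((hf0.eventually_gt_atTop 0).and (Ioo_mem_nhdsGT ht)).exists
  rw [hfg s hs'.1] at hs
  exact (one_div_pos.1 hs).trans_le (hg.isBernsteinPair.monotoneOn hs'.1 ht hs'.2.le)

/-- As `g'` decreases, the mean value theorem on `[s, α]` gives `(α - s) g'(α) ≤ g α - g s ≤ g α`;
let `s ↘ 0`. -/
theorem IsBernsteinPair.mul_deriv_le {g : ℝ → ℝ} {D : ℕ → ℝ → ℝ} (h : IsBernsteinPair g D)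
    {α : ℝ} (hα : 0 < α) : α * D 0 α ≤ g α := by
  have hlim : Tendsto (fun s => (α - s) * D 0 α) (𝓝[>] 0) (𝓝 (α * D 0 α)) := by
    have : ContinuousAt (fun s => (α - s) * D 0 α) 0 := by fun_prop
    have h3 := this.tendsto.mono_left (nhdsWithin_le_nhds (s := Ioi 0))
    simpa using h3
  refine le_of_tendsto hlim ?_
  filter_upwards [Ioo_mem_nhdsGT hα] with s hs
  obtain ⟨c, hc, hc'⟩ := exists_hasDerivAt_eq_slope g (D 0) hs.2
    (fun t ht => (h.hasDerivAt t (hs.1.trans_le ht.1)).continuousAt.continuousWithinAt)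
    (fun t ht => h.hasDerivAt t (hs.1.trans ht.1))
  have h1 := h.cm.antitoneOn 0 (hs.1.trans hc.1) hα hc.2.le
  rw [hc', le_div_iff₀ (by linarith [hs.2])] at h1
  linarith [h.nonneg s hs.1]

/-- The increment is completely monotone because `g'` is, and is bounded by its limit at `0`, which
is at most `g α` since `g ≥ 0`. -/
theorem IsBernsteinPair.exists_measure_sub {g : ℝ → ℝ} {D : ℕ → ℝ → ℝ} (h : IsBernsteinPair g D)
    {α : ℝ} (hα : 0 < α) :
    ∃ m : Measure ℝ≥0, IsFiniteMeasure m ∧ m.real univ ≤ g α ∧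
      ∀ t, 0 < t → laplaceReal m t = g (t + α) - g t := by
  let F : ℕ → ℝ → ℝ := fun n => Nat.casesOn n (fun t => g (t + α) - g t)
    fun n t => D n t - D n (t + α)
  have hF : IsCMFamily F := by
    intro n t ht
    cases n with
    | zero =>
      refine ⟨sub_nonneg.2 (h.monotoneOn ht (show 0 < t + α by linarith) (by linarith)), ?_⟩
      refine (((h.hasDerivAt (t + α) (by linarith)).comp_add_const t α).sub
        (h.hasDerivAt t ht)).congr_deriv ?_
      change _ = -(D 0 t - D 0 (t + α))
      ring
    | succ n => exact h.cm.sub_comp_add hα.le n t ht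
  refine hF.exists_measure fun t ht => ?_
  have hlim : Tendsto (fun s => g (s + α)) (𝓝[>] 0) (𝓝 (g α)) := by
    have h1 : ContinuousAt g (0 + α) := (h.hasDerivAt (0 + α) (by linarith)).continuousAt
    have h2 : ContinuousAt (fun s => g (s + α)) 0 :=
      ContinuousAt.comp (f := fun s => s + α) h1 (by fun_prop)
    have h3 := h2.tendsto.mono_left (nhdsWithin_le_nhds (s := Ioi 0))
    simpa using h3
  refine ge_of_tendsto hlim ?_
  filter_upwards [Ioo_mem_nhdsGT ht] with s hs
  have h1 : g (t + α) - g t ≤ g (s + α) - g s := hF.antitoneOn 0 hs.1 ht hs.2.le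
  change g (t + α) - g t ≤ g (s + α)
  linarith [h.nonneg s hs.1]

/-- The slope is `∫₀¹ g'(α + rt) dr`. If `l` represents `g'(α + ·)`, the image of `l ⊗ dr` under
`(s, r) ↦ sr` represents the slope; its mass is at most `g'(α) ≤ g α / α`. -/
theorem IsBernsteinPair.exists_measure_slope {g : ℝ → ℝ} {D : ℕ → ℝ → ℝ}
    (h : IsBernsteinPair g D) {α : ℝ} (hα : 0 < α) :
    ∃ m : Measure ℝ≥0, IsFiniteMeasure m ∧ m.real univ ≤ g α / α ∧
      ∀ t, 0 < t → t * laplaceReal m t = g (t + α) - g α := by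
  obtain ⟨l, hl, hlC, hlL⟩ := (h.cm.comp_add hα.le).exists_measure (C := D 0 α) fun t ht =>
    h.cm.antitoneOn 0 hα (show 0 < t + α by linarith) (by linarith)
  have hmeas : Measurable fun p : ℝ≥0 × ℝ => p.1 * p.2.toNNReal := by fun_prop
  refine ⟨(l.prod (volume.restrict (Ioc (0 : ℝ) 1))).map fun p => p.1 * p.2.toNNReal,
    inferInstance, ?_, fun t ht => ?_⟩
  · rw [map_measureReal_apply hmeas MeasurableSet.univ, preimage_univ, measureReal_def,
      ← univ_prod_univ, Measure.prod_prod, ENNReal.toReal_mul]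
    have h1 := h.mul_deriv_le hα
    rw [le_div_iff₀ hα]
    simp only [Measure.restrict_apply_univ, Real.volume_Ioc, sub_zero, ENNReal.ofReal_one,
      ENNReal.toReal_one, mul_one]
    change l.real univ * α ≤ _
    nlinarith
  · have hint : Integrable (fun p : ℝ≥0 × ℝ => Real.exp (-(t * (p.1 * p.2.toNNReal : ℝ≥0))))
        (l.prod (volume.restrict (Ioc (0 : ℝ) 1))) := by
      refine Integrable.of_bound (C := 1) (by fun_prop) (ae_of_all _ fun p => ?_)
      rw [Real.norm_eq_abs, abs_of_pos (Real.exp_pos _)]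
      exact Real.exp_le_one_iff.2 (by
        have : 0 ≤ t * (p.1 * p.2.toNNReal : ℝ≥0) := by positivity
        linarith)
    have e1 : laplaceReal ((l.prod (volume.restrict (Ioc (0 : ℝ) 1))).map
        fun p => p.1 * p.2.toNNReal) t = ∫ r in Ioc (0 : ℝ) 1, D 0 (t * r + α) := by
      unfold laplaceReal
      rw [integral_map hmeas.aemeasurable (by fun_prop), integral_prod_symm _ hint]
      refine setIntegral_congr_fun measurableSet_Ioc fun r hr => ?_
      have := hlL (t * r) (mul_pos ht hr.1)
      simp only [← this, laplaceReal]
      refine integral_congr_ae (ae_of_all _ fun s => ?_)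
      simp only [NNReal.coe_mul, Real.coe_toNNReal _ hr.1.le]
      ring_nf
    have hpos : ∀ r ∈ uIcc (0 : ℝ) 1, 0 < t * r + α := by
      intro r hr
      rw [uIcc_of_le zero_le_one] at hr
      have := mul_nonneg ht.le hr.1
      linarith
    have hder : ∀ r ∈ uIcc (0 : ℝ) 1, HasDerivAt (fun r => g (t * r + α)) (t * D 0 (t * r + α)) r := by
      intro r hr
      have h1 : HasDerivAt (fun r : ℝ => t * r + α) t r := by
        simpa using ((hasDerivAt_id r).const_mul t).add_const α
      have := (h.hasDerivAt _ (hpos r hr)).comp r h1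
      rw [mul_comm] at this
      exact this
    have hcont : ContinuousOn (fun r => t * D 0 (t * r + α)) (uIcc 0 1) :=
      continuousOn_const.mul ((h.cm.continuousOn 0).comp (by fun_prop) hpos)
    have h2 := intervalIntegral.integral_eq_sub_of_hasDerivAt hder hcont.intervalIntegrable
    rw [intervalIntegral.integral_const_mul, intervalIntegral.integral_of_le zero_le_one] at h2
    rw [e1, h2]
    simp

/-! ### Cesàro and exponential measures -/

/-- The uniform probability measure on `[0, t]`. -/
def cesaroMeasure (t : ℝ) : Measure ℝ≥0 :=
  ENNReal.ofReal t⁻¹ • (volume.restrict (Ioc 0 t)).map Real.toNNReal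

instance (t : ℝ) : IsFiniteMeasure (cesaroMeasure t) := by
  unfold cesaroMeasure
  exact Measure.smul_finite _ (by simp)

theorem integral_cesaroMeasure {E : Type*} [NormedAddCommGroup E] [NormedSpace ℝ E] {t : ℝ}
    (ht : 0 < t) {F : ℝ≥0 → E} (hF : Continuous F) :
    ∫ s, F s ∂(cesaroMeasure t) = t⁻¹ • ∫ s in (0 : ℝ)..t, F s.toNNReal := by
  rw [cesaroMeasure, integral_smul_measure, integral_map (by fun_prop) hF.aestronglyMeasurable,
    ENNReal.toReal_ofReal (by positivity), intervalIntegral.integral_of_le ht.le]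

theorem cesaroMeasure_real_univ {t : ℝ} (ht : 0 < t) : (cesaroMeasure t).real univ = 1 := by
  have := integral_cesaroMeasure ht (F := fun _ => (1 : ℝ)) continuous_const
  simp only [integral_const, smul_eq_mul, mul_one, intervalIntegral.integral_const, sub_zero] at this
  rw [this, inv_mul_cancel₀ ht.ne']

theorem laplaceReal_cesaroMeasure {t z : ℝ} (ht : 0 < t) (hz : 0 < z) :
    laplaceReal (cesaroMeasure t) z = (1 - Real.exp (-(z * t))) / (t * z) := by
  unfold laplaceReal
  rw [integral_cesaroMeasure ht (by fun_prop)]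
  have h1 : ∫ s in (0 : ℝ)..t, Real.exp (-(z * s.toNNReal)) = ∫ s in (0 : ℝ)..t, Real.exp (-z * s) := by
    refine intervalIntegral.integral_congr fun s hs => ?_
    rw [uIcc_of_le ht.le] at hs
    simp only [Real.coe_toNNReal _ hs.1, neg_mul]
  rw [h1, intervalIntegral.integral_comp_mul_left (fun x => Real.exp x) (neg_ne_zero.2 hz.ne'),
    integral_exp]
  simp only [mul_zero, Real.exp_zero, smul_eq_mul, neg_mul]
  field_simp
  ring

/-- The measure `e^{-s} ds` on `[0, ∞)`. -/
def expMeasure : Measure ℝ≥0 :=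
  ((volume.restrict (Ioi 0)).withDensity fun s : ℝ => ENNReal.ofReal (Real.exp (-s))).map
    Real.toNNReal

theorem integral_expMeasure {E : Type*} [NormedAddCommGroup E] [NormedSpace ℝ E]
    {F : ℝ≥0 → E} (hF : Continuous F) :
    ∫ s, F s ∂expMeasure = ∫ s in Ioi (0 : ℝ), Real.exp (-s) • F s.toNNReal := by
  rw [expMeasure, integral_map (by fun_prop) hF.aestronglyMeasurable,
    integral_withDensity_eq_integral_toReal_smul (by fun_prop) (by simp)]
  simp only [ENNReal.toReal_ofReal (Real.exp_pos _).le]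

instance : IsFiniteMeasure expMeasure := by
  have : IsFiniteMeasure ((volume.restrict (Ioi 0)).withDensity
      fun s : ℝ => ENNReal.ofReal (Real.exp (-s))) :=
    isFiniteMeasure_withDensity_ofReal (integrableOn_exp_neg_Ioi 0).2
  unfold expMeasure
  infer_instance

theorem laplace_expMeasure {z : ℂ} (hz : 0 < z.re) : laplace expMeasure z = 1 / (1 + z) := by
  unfold laplace
  rw [integral_expMeasure (by fun_prop)]
  have h1 : ∫ s in Ioi (0 : ℝ), Real.exp (-s) • Complex.exp (-(z * (s.toNNReal : ℝ))) =
      ∫ s in Ioi (0 : ℝ), Complex.exp (-(1 + z) * s) := by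
    refine setIntegral_congr_fun measurableSet_Ioi fun s hs => ?_
    simp only [Real.coe_toNNReal _ (le_of_lt hs), Complex.real_smul, Complex.ofReal_exp,
      ← Complex.exp_add]
    push_cast
    ring_nf
  rw [h1, integral_exp_mul_complex_Ioi (by simp; linarith)]
  rw [Complex.ofReal_zero, mul_zero, Complex.exp_zero, neg_div_neg_eq]

theorem laplaceReal_expMeasure {t : ℝ} (ht : 0 < t) : laplaceReal expMeasure t = 1 / (1 + t) := by
  have := laplace_expMeasure (z := t) (by simpa using ht)
  rw [laplace_ofReal] at this
  exact_mod_cast this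

/-! ### Convolution and the Hille-Phillips calculus for positive measures -/

theorem laplaceReal_add (a b : Measure ℝ≥0) [IsFiniteMeasure a] [IsFiniteMeasure b] {t : ℝ}
    (ht : 0 < t) : laplaceReal (a + b) t = laplaceReal a t + laplaceReal b t :=
  integral_add_measure (integrable_exp_neg a ht.le) (integrable_exp_neg b ht.le)

theorem laplaceReal_conv (a b : Measure ℝ≥0) [IsFiniteMeasure a] [IsFiniteMeasure b]
    (t : ℝ) : laplaceReal (a.conv b) t = laplaceReal a t * laplaceReal b t := by
  unfold laplaceReal Measure.conv
  rw [integral_map (by fun_prop) (by fun_prop), ← integral_prod_mul]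
  refine integral_congr_ae (ae_of_all _ fun p => ?_)
  simp only [NNReal.coe_add, ← Real.exp_add]
  ring_nf

theorem laplaceReal_dirac (s : ℝ≥0) (t : ℝ) :
    laplaceReal (Measure.dirac s) t = Real.exp (-(t * s)) := by
  unfold laplaceReal
  rw [integral_dirac]

namespace BoundedC0Semigroup

variable {X : Type*} [NormedAddCommGroup X] [NormedSpace ℂ X] (T : BoundedC0Semigroup X)

theorem exists_bound : ∃ M : ℝ, 0 ≤ M ∧ ∀ s, ‖T.op s‖ ≤ M := by
  obtain ⟨M, hM⟩ := T.bounded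
  exact ⟨M, (norm_nonneg _).trans (hM 0), hM⟩

theorem integrable_orbit (a : Measure ℝ≥0) [IsFiniteMeasure a] (x : X) :
    Integrable (fun s => T.op s x) a := by
  obtain ⟨M, -, hM⟩ := T.exists_bound
  exact Integrable.of_bound (T.continuous_orbit x).aestronglyMeasurable (M * ‖x‖)
    (ae_of_all _ fun s => (T.op s).le_of_opNorm_le (hM s) x)

theorem norm_integral_orbit_le {M : ℝ} (hM : ∀ s, ‖T.op s‖ ≤ M) (a : Measure ℝ≥0)
    [IsFiniteMeasure a] (x : X) : ‖∫ s, T.op s x ∂a‖ ≤ M * a.real univ * ‖x‖ := by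
  refine (norm_integral_le_of_norm_le_const
    (ae_of_all _ fun s => (T.op s).le_of_opNorm_le (hM s) x)).trans (le_of_eq ?_)
  ring

/-- The operator `∫ T(s) a(ds)`. -/
def integ (a : Measure ℝ≥0) [IsFiniteMeasure a] : X →L[ℂ] X :=
  LinearMap.mkContinuousOfExistsBound
    { toFun := fun x => ∫ s, T.op s x ∂a
      map_add' := fun x y => by
        simp only [map_add]
        exact integral_add (T.integrable_orbit a x) (T.integrable_orbit a y)
      map_smul' := fun c x => by
        simp only [map_smul, RingHom.id_apply]
        exact integral_smul c _ } (by
    obtain ⟨M, -, hM⟩ := T.exists_bound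
    exact ⟨_, fun x => T.norm_integral_orbit_le hM a x⟩)

theorem integ_apply (a : Measure ℝ≥0) [IsFiniteMeasure a] (x : X) :
    T.integ a x = ∫ s, T.op s x ∂a := rfl

theorem norm_integ_le {M : ℝ} (hM : ∀ s, ‖T.op s‖ ≤ M) (a : Measure ℝ≥0)
    [IsFiniteMeasure a] : ‖T.integ a‖ ≤ M * a.real univ :=
  ContinuousLinearMap.opNorm_le_bound _
    (mul_nonneg ((norm_nonneg _).trans (hM 0)) measureReal_nonneg)
    (T.norm_integral_orbit_le hM a)

theorem integ_add (a b : Measure ℝ≥0) [IsFiniteMeasure a] [IsFiniteMeasure b] :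
    T.integ (a + b) = T.integ a + T.integ b := by
  ext x
  exact integral_add_measure (T.integrable_orbit a x) (T.integrable_orbit b x)

theorem integ_dirac [CompleteSpace X] (s : ℝ≥0) : T.integ (Measure.dirac s) = T.op s := by
  ext x
  exact integral_dirac _ _

theorem integ_conv [CompleteSpace X] (a b : Measure ℝ≥0) [IsFiniteMeasure a] [IsFiniteMeasure b] :
    T.integ (a.conv b) = T.integ a * T.integ b := by
  ext x
  have hint : Integrable (fun p : ℝ≥0 × ℝ≥0 => T.op (p.1 + p.2) x) (a.prod b) := by
    obtain ⟨M, -, hM⟩ := T.exists_bound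
    have hc : Continuous fun p : ℝ≥0 × ℝ≥0 => T.op (p.1 + p.2) x :=
      (T.continuous_orbit x).comp continuous_add
    exact Integrable.of_bound hc.aestronglyMeasurable (M * ‖x‖)
      (ae_of_all _ fun p => (T.op _).le_of_opNorm_le (hM _) x)
  rw [integ_apply, Measure.conv, integral_map (by fun_prop)
    (T.continuous_orbit x).aestronglyMeasurable, integral_prod _ hint, mul_apply_eq_comp,
    integ_apply]
  refine integral_congr_ae (ae_of_all _ fun s => ?_)
  simp only [integ_apply, T.op_add, mul_apply_eq_comp]
  exact ContinuousLinearMap.integral_comp_comm (T.op s) (T.integrable_orbit b x)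

/-- `B = G(A)` where `G` is on `(0, ∞)` a difference of Laplace transforms of finite positive
measures. -/
def Represents (G : ℝ → ℝ) (B : X →L[ℂ] X) : Prop :=
  ∃ (a b : Measure ℝ≥0) (_ : IsFiniteMeasure a) (_ : IsFiniteMeasure b),
    (∀ t, 0 < t → G t = laplaceReal a t - laplaceReal b t) ∧ B = T.integ a - T.integ b

variable {T} {G H : ℝ → ℝ} {B C : X →L[ℂ] X}

theorem Represents.congr (h : T.Represents G B) (e : ∀ t, 0 < t → H t = G t) :
    T.Represents H B := by
  obtain ⟨a, b, ha, hb, h1, h2⟩ := h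
  exact ⟨a, b, ha, hb, fun t ht => (e t ht).trans (h1 t ht), h2⟩

/-- Moving the negative parts across yields two positive measures with equal transforms, so
uniqueness for positive measures makes the operator depend on the symbol only. -/
theorem Represents.unique (h : T.Represents G B) (h' : T.Represents H C)
    (e : ∀ t, 0 < t → G t = H t) : B = C := by
  obtain ⟨a, b, ha, hb, h1, rfl⟩ := h
  obtain ⟨c, d, hc, hd, h3, rfl⟩ := h'
  have : a + d = c + b := measure_ext_of_laplaceReal_nat fun n hn => by
    have hn' : (0 : ℝ) < n := by exact_mod_cast hn
    rw [laplaceReal_add _ _ hn', laplaceReal_add _ _ hn']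
    linarith [h1 n hn', h3 n hn', e n hn']
  rw [sub_eq_sub_iff_add_eq_add, ← integ_add, ← integ_add]
  congr 1

theorem Represents.neg (h : T.Represents G B) : T.Represents (fun t => -G t) (-B) := by
  obtain ⟨a, b, ha, hb, h1, rfl⟩ := h
  exact ⟨b, a, hb, ha, fun t ht => by beta_reduce; rw [h1 t ht]; ring, by abel⟩

theorem Represents.add (h : T.Represents G B) (h' : T.Represents H C) :
    T.Represents (fun t => G t + H t) (B + C) := by
  obtain ⟨a, b, ha, hb, h1, rfl⟩ := h
  obtain ⟨c, d, hc, hd, h3, rfl⟩ := h'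
  refine ⟨a + c, b + d, inferInstance, inferInstance, fun t ht => ?_, ?_⟩
  · beta_reduce
    rw [laplaceReal_add _ _ ht, laplaceReal_add _ _ ht, h1 t ht, h3 t ht]; ring
  · rw [integ_add, integ_add]; abel

theorem Represents.sub (h : T.Represents G B) (h' : T.Represents H C) :
    T.Represents (fun t => G t - H t) (B - C) := by
  simpa only [sub_eq_add_neg] using h.add h'.neg

theorem represents_integ (T : BoundedC0Semigroup X) (a : Measure ℝ≥0) [IsFiniteMeasure a] :
    T.Represents (laplaceReal a) (T.integ a) := by
  refine ⟨a, 0, inferInstance, inferInstance, fun t _ => ?_, ?_⟩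
  · simp [laplaceReal]
  · ext x; simp [integ_apply]

theorem Represents.smul (h : T.Represents G B) (c : ℝ) :
    T.Represents (fun t => c * G t) (c • B) := by
  have key : ∀ c : ℝ, 0 ≤ c → T.Represents (fun t => c * G t) (c • B) := by
    intro c hc
    obtain ⟨a, b, ha, hb, h1, rfl⟩ := h
    refine ⟨ENNReal.ofReal c • a, ENNReal.ofReal c • b, Measure.smul_finite _ (by simp),
      Measure.smul_finite _ (by simp), fun t ht => ?_, ?_⟩
    · beta_reduce
      rw [h1 t ht]
      unfold laplaceReal
      rw [integral_smul_measure, integral_smul_measure, ENNReal.toReal_ofReal hc, smul_eq_mul,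
        smul_eq_mul, mul_sub]
    · ext x
      simp only [smul_apply, sub_apply, integ_apply,
        integral_smul_measure, ENNReal.toReal_ofReal hc, smul_sub]
  rcases le_total 0 c with hc | hc
  · exact key c hc
  · have := (key (-c) (neg_nonneg.2 hc)).neg
    simpa only [neg_mul, neg_neg, neg_smul] using this

theorem Represents.mul [CompleteSpace X] (h : T.Represents G B) (h' : T.Represents H C) :
    T.Represents (fun t => G t * H t) (B * C) := by
  obtain ⟨a, b, ha, hb, h1, rfl⟩ := h
  obtain ⟨c, d, hc, hd, h3, rfl⟩ := h'
  refine ⟨a.conv c + b.conv d, a.conv d + b.conv c, inferInstance, inferInstance,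
    fun t ht => ?_, ?_⟩
  · beta_reduce
    rw [laplaceReal_add _ _ ht, laplaceReal_add _ _ ht, laplaceReal_conv,
      laplaceReal_conv, laplaceReal_conv, laplaceReal_conv, h1 t ht, h3 t ht]
    ring
  · rw [integ_add, integ_add, integ_conv, integ_conv, integ_conv, integ_conv]
    noncomm_ring

theorem represents_op [CompleteSpace X] (T : BoundedC0Semigroup X) (s : ℝ≥0) :
    T.Represents (fun t => Real.exp (-(t * s))) (T.op s) := by
  have := T.represents_integ (Measure.dirac s)
  rw [integ_dirac] at this
  exact this.congr fun t _ => (laplaceReal_dirac s t).symm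

theorem represents_one [CompleteSpace X] (T : BoundedC0Semigroup X) :
    T.Represents (fun _ => 1) 1 := by
  have := T.represents_op 0
  rw [T.op_zero] at this
  simpa using this

end BoundedC0Semigroup

/-! ### Exponential tilting -/

/-- The measure `e^{-αs} a(ds)`. -/
def expTilt (α : ℝ) (a : Measure ℝ≥0) : Measure ℝ≥0 :=
  a.withDensity fun s => ENNReal.ofReal (Real.exp (-(α * s)))

theorem integral_expTilt {E : Type*} [NormedAddCommGroup E] [NormedSpace ℝ E] (α : ℝ)
    (a : Measure ℝ≥0) (F : ℝ≥0 → E) :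
    ∫ s, F s ∂(expTilt α a) = ∫ s, Real.exp (-(α * s)) • F s ∂a := by
  rw [expTilt, integral_withDensity_eq_integral_toReal_smul (by fun_prop) (by simp)]
  simp only [ENNReal.toReal_ofReal (Real.exp_pos _).le]

theorem laplaceReal_expTilt (α : ℝ) (a : Measure ℝ≥0) (t : ℝ) :
    laplaceReal (expTilt α a) t = laplaceReal a (t + α) := by
  rw [laplaceReal, integral_expTilt]
  refine integral_congr_ae (ae_of_all _ fun s => ?_)
  simp only [smul_eq_mul, ← Real.exp_add]
  ring_nf

theorem LaplaceTransformable.isFiniteMeasure_expTilt {μ : Measure ℝ≥0}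
    (hμ : LaplaceTransformable μ) {α : ℝ} (hα : 0 < α) : IsFiniteMeasure (expTilt α μ) :=
  isFiniteMeasure_withDensity_ofReal (hμ α hα).2

theorem laplaceTransformable_of_isFiniteMeasure (a : Measure ℝ≥0) [IsFiniteMeasure a] :
    LaplaceTransformable a := fun _ ht => integrable_exp_neg a ht.le

theorem expTilt_real_univ (α : ℝ) (a : Measure ℝ≥0) :
    (expTilt α a).real univ = laplaceReal a α := by
  have := integral_expTilt α a (fun _ => (1 : ℝ))
  simpa [laplaceReal] using this

namespace BoundedC0Semigroup

variable {X : Type*} [NormedAddCommGroup X] [NormedSpace ℂ X] {T : BoundedC0Semigroup X}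

theorem norm_integ_sub_integ_expTilt_le {M : ℝ} (hM : ∀ s, ‖T.op s‖ ≤ M) (a : Measure ℝ≥0)
    [IsFiniteMeasure a] {α : ℝ} (hα : 0 < α) [IsFiniteMeasure (expTilt α a)] :
    ‖T.integ a - T.integ (expTilt α a)‖ ≤ M * (a.real univ - laplaceReal a α) := by
  have hM0 : 0 ≤ M := (norm_nonneg _).trans (hM 0)
  have hexp := integrable_exp_neg a hα.le
  have e1 : a.real univ - laplaceReal a α = ∫ s : ℝ≥0, (1 - Real.exp (-(α * s))) ∂a := by
    rw [integral_sub (integrable_const _) hexp]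
    simp [laplaceReal]
  have hle : ∀ s : ℝ≥0, 0 ≤ 1 - Real.exp (-(α * s)) := fun s => by
    have h1 : 0 ≤ α * s := mul_nonneg hα.le s.2
    have : Real.exp (-(α * s)) ≤ 1 := Real.exp_le_one_iff.2 (by linarith)
    linarith
  refine ContinuousLinearMap.opNorm_le_bound _ ?_ fun x => ?_
  · rw [e1]
    exact mul_nonneg hM0 (integral_nonneg hle)
  · have hi : Integrable (fun s : ℝ≥0 => Real.exp (-(α * s)) • T.op s x) a := by
      have hc : Continuous fun s : ℝ≥0 => Real.exp (-(α * s)) := by fun_prop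
      refine Integrable.of_bound (C := M * ‖x‖)
        (hc.smul (T.continuous_orbit x)).aestronglyMeasurable (ae_of_all _ fun s => ?_)
      rw [norm_smul, Real.norm_of_nonneg (Real.exp_pos _).le]
      exact (mul_le_of_le_one_left (norm_nonneg _) (by linarith [hle s])).trans
        ((T.op s).le_of_opNorm_le (hM s) x)
    rw [sub_apply, integ_apply, integ_apply, integral_expTilt,
      ← integral_sub (T.integrable_orbit a x) hi, e1, mul_comm M, mul_assoc, ← integral_mul_const]
    refine norm_integral_le_of_norm_le ?_ (ae_of_all _ fun s => ?_)
    · exact ((integrable_const _).sub hexp).mul_const _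
    · have : T.op s x - Real.exp (-(α * s)) • T.op s x = (1 - Real.exp (-(α * s))) • T.op s x := by
        rw [sub_smul, one_smul]
      rw [this, norm_smul, Real.norm_of_nonneg (hle s)]
      exact mul_le_mul_of_nonneg_left ((T.op s).le_of_opNorm_le (hM s) x) (hle s)

/-- Shifting the symbol tilts the measure by `e^{-αs}`; the operator norm of the error is at most
`M` times the lost mass, which tends to `0`. -/
theorem exists_represents_shift_integ (T : BoundedC0Semigroup X) (a : Measure ℝ≥0)
    [IsFiniteMeasure a] :
    ∃ B' : ℝ → X →L[ℂ] X, (∀ α, 0 < α → T.Represents (fun t => laplaceReal a (t + α)) (B' α)) ∧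
      Tendsto B' (𝓝[>] 0) (𝓝 (T.integ a)) := by
  have hfin : ∀ α, 0 < α → IsFiniteMeasure (expTilt α a) := fun α hα =>
    (laplaceTransformable_of_isFiniteMeasure a).isFiniteMeasure_expTilt hα
  let B' : ℝ → X →L[ℂ] X := fun α =>
    if hα : 0 < α then haveI := hfin α hα; T.integ (expTilt α a) else 0
  have hB' : ∀ α (hα : 0 < α), B' α = (haveI := hfin α hα; T.integ (expTilt α a)) :=
    fun α hα => dif_pos hα
  refine ⟨B', fun α hα => ?_, ?_⟩
  · have := hfin α hα
    rw [hB' α hα]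
    exact (T.represents_integ _).congr fun t _ => (laplaceReal_expTilt α a t).symm
  · obtain ⟨M, -, hM⟩ := T.exists_bound
    rw [tendsto_iff_norm_sub_tendsto_zero]
    have hlim : Tendsto (fun α => M * (a.real univ - laplaceReal a α)) (𝓝[>] 0) (𝓝 0) := by
      simpa using ((tendsto_laplaceReal_zero a).const_sub (a.real univ)).const_mul M
    refine squeeze_zero' (Eventually.of_forall fun _ => norm_nonneg _) ?_ hlim
    filter_upwards [self_mem_nhdsWithin] with α hα
    have := hfin α hα
    rw [hB' α hα, norm_sub_rev]
    exact norm_integ_sub_integ_expTilt_le hM a hα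

theorem Represents.exists_shift {G : ℝ → ℝ} {B : X →L[ℂ] X} (h : T.Represents G B) :
    ∃ B' : ℝ → X →L[ℂ] X, (∀ α, 0 < α → T.Represents (fun t => G (t + α)) (B' α)) ∧
      Tendsto B' (𝓝[>] 0) (𝓝 B) := by
  obtain ⟨a, b, ha, hb, h1, rfl⟩ := h
  obtain ⟨A', hA', hA⟩ := T.exists_represents_shift_integ a
  obtain ⟨B', hB', hB⟩ := T.exists_represents_shift_integ b
  exact ⟨fun α => A' α - B' α, fun α hα => ((hA' α hα).sub (hB' α hα)).congr
    fun t ht => h1 _ (by linarith), hA.sub hB⟩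

theorem represents_expTilt (T : BoundedC0Semigroup X) {μ : Measure ℝ≥0}
    (hμ : LaplaceTransformable μ) {α : ℝ} (hα : 0 < α) :
    ∃ F : X →L[ℂ] X, T.Represents (fun t => laplaceReal μ (t + α)) F ∧
      (∀ x, F x = ∫ s : ℝ≥0, Real.exp (-(α * s)) • T.op s x ∂μ) ∧
      ∀ M : ℝ, (∀ s, ‖T.op s‖ ≤ M) → ‖F‖ ≤ M * laplaceReal μ α := by
  have := hμ.isFiniteMeasure_expTilt hα
  refine ⟨T.integ (expTilt α μ), (T.represents_integ _).congr
    fun t _ => (laplaceReal_expTilt α μ t).symm, fun x => ?_, fun M hM => ?_⟩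
  · rw [integ_apply, integral_expTilt]
  · have := T.norm_integ_le hM (expTilt α μ)
    rwa [expTilt_real_univ] at this

/-! ### Passing to the weak limit -/

/-- Uniform boundedness: each functional is bounded near `0` by convergence, on an interval
depending on the functional, and beyond it by `hb`. -/
theorem _root_.Ergodic.exists_bound_of_weak_tendsto {u : ℝ → X} {y : X}
    (hu : ∀ φ : X →L[ℂ] ℂ, Tendsto (fun α => φ (u α)) (𝓝[>] 0) (𝓝 (φ y)))
    (hb : ∀ δ, 0 < δ → ∃ C, ∀ α, δ ≤ α → ‖u α‖ ≤ C) : ∃ K, ∀ α, 0 < α → ‖u α‖ ≤ K := by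
  obtain ⟨K, hK⟩ := banach_steinhaus
    (g := fun α : Ioi (0 : ℝ) => NormedSpace.inclusionInDoubleDual ℂ X (u α)) fun φ => by
      have h1 := (hu φ).norm.eventually_le_const (lt_add_one _)
      rw [eventually_nhdsWithin_iff, Metric.eventually_nhds_iff] at h1
      obtain ⟨δ, hδ, h1⟩ := h1
      obtain ⟨C, hC⟩ := hb δ hδ
      refine ⟨max (‖φ y‖ + 1) (‖φ‖ * C), fun α => ?_⟩
      change ‖φ (u α)‖ ≤ _
      rcases lt_or_ge (α : ℝ) δ with h | h
      · refine le_max_of_le_left (h1 ?_ α.2)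
        rw [Real.dist_eq, sub_zero, abs_of_pos α.2]
        exact h
      · exact le_max_of_le_right (φ.le_opNorm_of_le (hC α h))
  refine ⟨K, fun α hα => ?_⟩
  rw [← (NormedSpace.inclusionInDoubleDualLi ℂ (E := X)).norm_map]
  exact hK ⟨α, hα⟩

theorem apply_eq_of_represents [CompleteSpace X] {μ : Measure ℝ≥0} (hμ : LaplaceTransformable μ)
    {x y : X} (hxy : ∀ φ : X →L[ℂ] ℂ,
      Tendsto (fun α : ℝ => φ (∫ s : ℝ≥0, Real.exp (-(α * s)) • T.op s x ∂μ))
        (𝓝[>] 0) (𝓝 (φ y)))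
    {G H : ℝ → ℝ} {N R : X →L[ℂ] X} (hN : T.Represents G N) (hR : T.Represents H R)
    (e : ∀ t, 0 < t → G t = H t * laplaceReal μ t) : R y = N x := by
  obtain ⟨N', hN', hNlim⟩ := hN.exists_shift
  obtain ⟨R', hR', hRlim⟩ := hR.exists_shift
  obtain ⟨M, hM0, hM⟩ := T.exists_bound
  set u : ℝ → X := fun α => ∫ s : ℝ≥0, Real.exp (-(α * s)) • T.op s x ∂μ with hu
  have hanti : ∀ δ α, 0 < δ → δ ≤ α → laplaceReal μ α ≤ laplaceReal μ δ := by
    intro δ α hδ hα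
    refine integral_mono (hμ α (hδ.trans_le hα)) (hμ δ hδ) fun s => ?_
    exact Real.exp_le_exp.2 (neg_le_neg (mul_le_mul_of_nonneg_right hα s.2))
  obtain ⟨K, hK⟩ := exists_bound_of_weak_tendsto hxy fun δ hδ =>
    ⟨M * laplaceReal μ δ * ‖x‖, fun α hα => by
      obtain ⟨F, -, hF, hFn⟩ := T.represents_expTilt hμ (hδ.trans_le hα)
      rw [← hF x]
      refine F.le_of_opNorm_le ((hFn M hM).trans ?_) x
      exact mul_le_mul_of_nonneg_left (hanti δ α hδ hα) hM0⟩
  -- Multiplicativity of the calculus for the shifted identity `G(·+α) = H(·+α) f(·+α)`, where all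
  -- three symbols come from finite measures.
  have key : ∀ α, 0 < α → N' α x = R' α (u α) := by
    intro α hα
    obtain ⟨F, hFr, hF, -⟩ := T.represents_expTilt hμ hα
    have := (hN' α hα).unique ((hR' α hα).mul hFr) fun t ht => e _ (by linarith)
    rw [this, mul_apply_eq_comp, hF x]
  rw [SeparatingDual.eq_iff_forall_dual_eq (R := ℂ)]
  intro φ
  have l1 : Tendsto (fun α => φ (N' α x)) (𝓝[>] 0) (𝓝 (φ (N x))) :=
    (φ.continuous.tendsto _).comp (((ContinuousLinearMap.apply ℂ X x).continuous.tendsto N).comp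
      hNlim)
  have l2 : Tendsto (fun α => (R' α - R) (u α)) (𝓝[>] 0) (𝓝 0) := by
    have hlim : Tendsto (fun α => ‖R' α - R‖ * K) (𝓝[>] 0) (𝓝 0) := by
      have := (tendsto_iff_norm_sub_tendsto_zero.1 hRlim).mul_const K
      rwa [zero_mul] at this
    refine squeeze_zero_norm' ?_ hlim
    filter_upwards [self_mem_nhdsWithin] with α hα
    exact ContinuousLinearMap.le_opNorm_of_le _ (hK α hα)
  have l3 : Tendsto (fun α => φ ((R' α - R) (u α)) + (φ ∘L R) (u α)) (𝓝[>] 0)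
      (𝓝 (φ 0 + (φ ∘L R) y)) :=
    ((φ.continuous.tendsto 0).comp l2).add (hxy (φ ∘L R))
  rw [map_zero, zero_add] at l3
  refine tendsto_nhds_unique l3 (l1.congr' ?_)
  filter_upwards [self_mem_nhdsWithin] with α hα
  rw [key α hα, sub_apply, map_sub, ContinuousLinearMap.comp_apply, sub_add_cancel]

end BoundedC0Semigroup

/-- Hahn–Banach in the quotient by the closure. -/
theorem exists_dual_of_notMem_closure {X : Type*} [NormedAddCommGroup X]
    [NormedSpace ℂ X] (p : Submodule ℂ X) {y : X}
    (hy : y ∉ p.topologicalClosure) :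
    ∃ φ : X →L[ℂ] ℂ, (∀ w ∈ p, φ w = 0) ∧ φ y ≠ 0 := by
  have hcl : IsClosed (p.topologicalClosure : Set X) := p.isClosed_topologicalClosure
  have hne : (Submodule.Quotient.mk y : X ⧸ p.topologicalClosure) ≠ 0 := by
    rwa [Ne, Submodule.Quotient.mk_eq_zero]
  obtain ⟨f, hf⟩ := SeparatingDual.exists_ne_zero (R := ℂ) hne
  refine ⟨f ∘L p.topologicalClosure.mkQL, fun w hw => ?_, hf⟩
  have : (Submodule.Quotient.mk w : X ⧸ p.topologicalClosure) = 0 :=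
    (Submodule.Quotient.mk_eq_zero _).2 (p.le_topologicalClosure hw)
  change f (Submodule.Quotient.mk w) = 0
  rw [this, map_zero]

namespace BoundedC0Semigroup

variable {X : Type*} [NormedAddCommGroup X] [NormedSpace ℂ X] {T : BoundedC0Semigroup X}

/-! ### Cesàro averages -/

theorem integ_cesaroMeasure {t : ℝ} (ht : 0 < t) (x : X) :
    T.integ (cesaroMeasure t) x = T.cesaro t x :=
  integral_cesaroMeasure ht (T.continuous_orbit x)

theorem represents_cesaro (T : BoundedC0Semigroup X) {t : ℝ} (ht : 0 < t) :
    T.Represents (fun z => (1 - Real.exp (-(z * t))) / (t * z)) (T.integ (cesaroMeasure t)) :=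
  (T.represents_integ _).congr fun _ hz => (laplaceReal_cesaroMeasure ht hz).symm

variable [CompleteSpace X]

theorem exists_represents_cesaro_mul {g : ℝ → ℝ} {D : ℕ → ℝ → ℝ} (hg : IsBernsteinPair g D)
    {M : ℝ} (hM : ∀ s, ‖T.op s‖ ≤ M) {t : ℝ} (ht : 0 < t) :
    ∃ S : X →L[ℂ] X, T.Represents (fun z => (1 - Real.exp (-(z * t))) / (t * z) * g z) S ∧
      ‖S‖ ≤ (M + (1 + M) * M + M * M) * g (1 / t) := by
  have hM0 : 0 ≤ M := (norm_nonneg _).trans (hM 0)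
  have hα : 0 < 1 / t := by positivity
  have hgα := hg.nonneg _ hα
  obtain ⟨σ, hσ, hσm, hσL⟩ := hg.exists_measure_sub hα
  obtain ⟨h, hh, hhm, hhL⟩ := hg.exists_measure_slope hα
  set α := 1 / t with hαdef
  have hC := T.represents_cesaro ht
  have hop := T.represents_op t.toNNReal
  -- Obtained from `g(z) = g(α) + (g(z+α) - g(α)) - (g(z+α) - g(z))` times `C_t`; in the middle term
  -- the factor `1/z` of `C_t` moves to the slope. The choice `α = 1/t` makes all three norms
  -- comparable to `g(α)`.
  refine ⟨g α • T.integ (cesaroMeasure t) + t⁻¹ • ((1 - T.op t.toNNReal) * T.integ h) -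
    T.integ (cesaroMeasure t) * T.integ σ, ?_, ?_⟩
  · refine (((hC.smul (g α)).add (((T.represents_one.sub hop).mul
      (T.represents_integ h)).smul t⁻¹)).sub (hC.mul (T.represents_integ σ))).congr fun z hz => ?_
    have e1 := hhL z hz
    have e2 : laplaceReal h z = (g (z + α) - g α) / z := by
      rw [eq_div_iff hz.ne']; linarith
    rw [hσL z hz, e2, Real.coe_toNNReal _ ht.le]
    field_simp
    ring
  · have n1 : ‖T.integ (cesaroMeasure t)‖ ≤ M := by
      have := T.norm_integ_le hM (cesaroMeasure t)
      rwa [cesaroMeasure_real_univ ht, mul_one] at this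
    have n2 : ‖T.integ h‖ ≤ M * (t * g α) := by
      refine (T.norm_integ_le hM h).trans (mul_le_mul_of_nonneg_left (hhm.trans (le_of_eq ?_)) hM0)
      rw [hαdef]; field_simp
    have n3 : ‖T.integ σ‖ ≤ M * g α :=
      (T.norm_integ_le hM σ).trans (mul_le_mul_of_nonneg_left hσm hM0)
    have n4 : ‖(1 : X →L[ℂ] X) - T.op t.toNNReal‖ ≤ 1 + M :=
      (norm_sub_le _ _).trans (add_le_add ContinuousLinearMap.norm_id_le (hM _))
    calc _ ≤ ‖g α • T.integ (cesaroMeasure t)‖ + ‖t⁻¹ • ((1 - T.op t.toNNReal) * T.integ h)‖ +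
          ‖T.integ (cesaroMeasure t) * T.integ σ‖ :=
          (norm_sub_le _ _).trans (add_le_add_left (norm_add_le _ _) _)
      _ ≤ g α * M + t⁻¹ * ((1 + M) * (M * (t * g α))) + M * (M * g α) := by
          rw [norm_smul, norm_smul, Real.norm_of_nonneg hgα, Real.norm_of_nonneg (by positivity)]
          gcongr
          · exact (norm_mul_le _ _).trans (mul_le_mul n4 n2 (norm_nonneg _) (by positivity))
          · exact (norm_mul_le _ _).trans (mul_le_mul n1 n3 (norm_nonneg _) (by positivity))
      _ = _ := by field_simp

/-! ### Functionals vanishing on the range of the generator -/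

/-- The span of the ranges of the operators `1 - T(s)`. -/
def rangeSpan (T : BoundedC0Semigroup X) : Submodule ℂ X :=
  Submodule.span ℂ {w | ∃ (s : ℝ≥0) (v : X), w = v - T.op s v}

/-- A functional `φ` vanishing on the ranges of `1 - T(s)` is `T`-invariant, so the weak limit reads
`f(α) φ(x) → φ(y)`. As `f(α) → ∞`, this forces `φ(x) = 0` and then `φ(y) = 0`. -/
theorem mem_closure_rangeSpan {μ : Measure ℝ≥0} (hμ : LaplaceTransformable μ)
    (hf0 : Tendsto (laplaceReal μ) (𝓝[>] 0) atTop)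
    {x y : X} (hxy : ∀ φ : X →L[ℂ] ℂ,
      Tendsto (fun α : ℝ => φ (∫ s : ℝ≥0, Real.exp (-(α * s)) • T.op s x ∂μ))
        (𝓝[>] 0) (𝓝 (φ y))) : y ∈ T.rangeSpan.topologicalClosure := by
  by_contra hy
  obtain ⟨φ, hφ, hφy⟩ := exists_dual_of_notMem_closure _ hy
  have hinv : ∀ s v, φ (T.op s v) = φ v := fun s v => by
    have := hφ (v - T.op s v) (Submodule.subset_span ⟨s, v, rfl⟩)
    rw [map_sub, sub_eq_zero] at this
    exact this.symm
  have h1 : ∀ α, 0 < α →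
      φ (∫ s : ℝ≥0, Real.exp (-(α * s)) • T.op s x ∂μ) = laplaceReal μ α * φ x := by
    intro α hα
    have := hμ.isFiniteMeasure_expTilt hα
    rw [← integral_expTilt, ← ContinuousLinearMap.integral_comp_comm φ (T.integrable_orbit _ x)]
    simp only [hinv, integral_const, expTilt_real_univ, Complex.real_smul]
  have h2 : Tendsto (fun α => (laplaceReal μ α : ℂ) * φ x) (𝓝[>] 0) (𝓝 (φ y)) := by
    refine (hxy φ).congr' ?_
    filter_upwards [self_mem_nhdsWithin] with α hα using h1 α hα
  have h3 : Tendsto (fun α => ((laplaceReal μ α)⁻¹ : ℝ) * ‖(laplaceReal μ α : ℂ) * φ x‖) (𝓝[>] 0)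
      (𝓝 (0 * ‖φ y‖)) := (tendsto_inv_atTop_zero.comp hf0).mul h2.norm
  rw [zero_mul] at h3
  have h4 : ‖φ x‖ = 0 := by
    refine tendsto_nhds_unique (tendsto_const_nhds.congr' ?_) h3
    filter_upwards [hf0.eventually_gt_atTop 0] with α hα
    rw [norm_mul, Complex.norm_real, Real.norm_of_nonneg hα.le, inv_mul_cancel_left₀ hα.ne']
  have h5 : φ x = 0 := norm_eq_zero.1 h4
  simp only [h5, mul_zero] at h2
  exact hφy (tendsto_nhds_unique h2 tendsto_const_nhds)

/-! ### Rates -/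

theorem isLittleO_cesaro_mul {g : ℝ → ℝ} {M : ℝ} (hM : ∀ s, ‖T.op s‖ ≤ M) {K : ℝ}
    (hg : ∀ t, 0 < t → 0 < g t)
    {S : ℝ → X →L[ℂ] X}
    (hS : ∀ t, 0 < t → T.Represents (fun z => (1 - Real.exp (-(z * t))) / (t * z) * g z) (S t))
    (hSn : ∀ t, 0 < t → ‖S t‖ ≤ K * g (1 / t))
    (hlim : Tendsto (fun t => t * g (1 / t)) atTop atTop) {y : X}
    (hy : y ∈ T.rangeSpan.topologicalClosure) :
    (fun t => S t y) =o[atTop] fun t => g (1 / t) := by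
  have hrange : ∀ w ∈ T.rangeSpan, (fun t => S t w) =O[atTop] fun t : ℝ => t⁻¹ := by
    intro w hw
    induction hw using Submodule.span_induction with
    | zero => simpa using Asymptotics.isBigO_zero _ _
    | add u v _ _ hu hv => simpa only [map_add] using hu.add hv
    | smul c u _ hu =>
      simp only [map_smul]
      exact hu.const_smul_left c
    | mem w hw =>
      obtain ⟨s, v, rfl⟩ := hw
      rcases eq_or_ne s 0 with rfl | hs
      · simpa [T.op_zero] using Asymptotics.isBigO_zero _ _
      have hs' : (0 : ℝ) < s := by exact_mod_cast pos_iff_ne_zero.2 hs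
      refine Asymptotics.IsBigO.of_bound (s * ((1 + M) * ‖S s v‖)) ?_
      filter_upwards [eventually_gt_atTop 0] with t ht
      -- The factors `1 - e^{-zs}` and `1 - e^{-zt}` exchange roles: `C_t·(1 - e^{-zs}) = (s/t)(1 -
      -- e^{-zt})·C_s`. All dependence on `t` is then `1/t` times a bounded operator.
      have key : S t * (1 - T.op s) = (s / t : ℝ) • ((1 - T.op t.toNNReal) * S s) := by
        refine ((hS t ht).mul (T.represents_one.sub (T.represents_op s))).unique
          (((T.represents_one.sub (T.represents_op t.toNNReal)).mul (hS s hs')).smul (s / t))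
          fun z hz => ?_
        rw [Real.coe_toNNReal _ ht.le]
        field_simp
      have := congrArg (fun L : X →L[ℂ] X => L v) key
      simp only [mul_apply_eq_comp, sub_apply, one_apply_eq_self, smul_apply] at this
      rw [this, norm_smul, Real.norm_of_nonneg (by positivity), Real.norm_of_nonneg (by positivity)]
      have : ‖S s v - T.op t.toNNReal (S s v)‖ ≤ (1 + M) * ‖S s v‖ := by
        rw [add_mul, one_mul]
        exact (norm_sub_le _ _).trans (add_le_add le_rfl ((T.op _).le_of_opNorm_le (hM _) _))
      calc _ ≤ s / t * ((1 + M) * ‖S s v‖) := by gcongr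
        _ = _ := by ring
  rw [Asymptotics.isLittleO_iff]
  intro ε hε
  have hK : 0 < |K| + 1 := by positivity
  -- The error `y - w` costs at most `(ε/2) g(1/t)` by the uniform bound; `t g(1/t) ≥ 2c/ε` makes
  -- `c/t` equally small. `|K| + 1` only ensures a positive denominator.
  obtain ⟨w, hw, hyw⟩ := Metric.mem_closure_iff.1 hy (ε / (2 * (|K| + 1))) (by positivity)
  obtain ⟨c, hc, hcw⟩ := (hrange w hw).exists_pos
  filter_upwards [hcw.bound, eventually_gt_atTop 0, hlim.eventually_ge_atTop (2 * c / ε)]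
    with t h1 ht h2
  have hgt := hg (1 / t) (by positivity)
  have e : S t y = S t (y - w) + S t w := by rw [map_sub]; abel
  rw [e, Real.norm_of_nonneg hgt.le]
  have b1 : ‖S t (y - w)‖ ≤ ε / 2 * g (1 / t) := by
    calc _ ≤ (|K| + 1) * g (1 / t) * (ε / (2 * (|K| + 1))) := by
          refine (S t).le_of_opNorm_le_of_le ((hSn t ht).trans ?_) ?_
          · gcongr
            linarith [le_abs_self K]
          · rw [← dist_eq_norm]; exact hyw.le
      _ = _ := by field_simp
  have b2 : ‖S t w‖ ≤ ε / 2 * g (1 / t) := by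
    refine h1.trans ?_
    rw [Real.norm_of_nonneg (by positivity)]
    rw [div_le_iff₀ hε] at h2
    rw [← div_eq_mul_inv, div_le_iff₀ ht]
    linarith
  calc _ ≤ ‖S t (y - w)‖ + ‖S t w‖ := norm_add_le _ _
    _ ≤ _ := by linarith

/-! ### The resolvent -/

theorem tendsto_cesaro_zero (x : X) : Tendsto (fun h => T.cesaro h x) (𝓝[>] 0) (𝓝 x) := by
  have hc : Continuous fun s : ℝ => T.op s.toNNReal x :=
    (T.continuous_orbit x).comp continuous_real_toNNReal
  have h := intervalIntegral.integral_hasDerivAt_right (hc.intervalIntegrable 0 0)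
    hc.stronglyMeasurable.stronglyMeasurableAtFilter hc.continuousAt
  have h1 := (hasDerivAt_iff_tendsto_slope_zero.1 h).mono_left
    (nhdsWithin_mono (0 : ℝ) fun t (ht : t ∈ Ioi (0 : ℝ)) => ne_of_gt ht)
  simpa [T.op_zero, cesaro] using h1

/-- From `C_h·(1+z) = C_h + h⁻¹(1 - e^{-zh})`, every Cesàro operator factors through the operator
with symbol `1/(1+z)`. A vector in its kernel has zero averages, and these tend to the vector
itself. -/
theorem integ_expMeasure_injective : Function.Injective (T.integ expMeasure) := by
  rw [injective_iff_map_eq_zero]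
  intro u hu
  have key : ∀ h : ℝ, 0 < h → T.cesaro h u = 0 := by
    intro h hh
    have hC := T.represents_cesaro hh
    have : T.integ (cesaroMeasure h) =
        (T.integ (cesaroMeasure h) + h⁻¹ • (1 - T.op h.toNNReal)) * T.integ expMeasure := by
      refine hC.unique ((hC.add ((T.represents_one.sub (T.represents_op h.toNNReal)).smul h⁻¹)).mul
        (T.represents_integ expMeasure)) fun z hz => ?_
      rw [laplaceReal_expMeasure hz, Real.coe_toNNReal _ hh.le]
      have : 1 + z ≠ 0 := by positivity
      field_simp
    rw [← integ_cesaroMeasure hh, this, mul_apply_eq_comp, hu, map_zero]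
  refine tendsto_nhds_unique (tendsto_cesaro_zero (T := T) u) (tendsto_const_nhds.congr' ?_)
  filter_upwards [self_mem_nhdsWithin] with h hh using (key h hh).symm

end BoundedC0Semigroup

/-! ### Holomorphy of Laplace transforms -/

theorem LaplaceTransformable.differentiableOn {μ : Measure ℝ≥0} (hμ : LaplaceTransformable μ) :
    DifferentiableOn ℂ (laplace μ) {z : ℂ | 0 < z.re} := by
  -- The Laplace transform is the complex moment generating function of `s` at `-z`, which is known
  -- to be holomorphic.
  have h1 : ∀ z, ProbabilityTheory.complexMGF (fun s : ℝ≥0 => (s : ℝ)) μ (-z) = laplace μ z := by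
    intro z
    unfold ProbabilityTheory.complexMGF laplace
    simp only [neg_mul]
  have hsub : Iio 0 ⊆ ProbabilityTheory.integrableExpSet (fun s : ℝ≥0 => (s : ℝ)) μ := by
    intro t ht
    have := hμ (-t) (neg_pos.2 ht)
    simpa [ProbabilityTheory.integrableExpSet] using this
  have hint := interior_maximal hsub isOpen_Iio
  intro z hz
  have h2 := (ProbabilityTheory.differentiableOn_complexMGF (X := fun s : ℝ≥0 => (s : ℝ)) (μ := μ)).comp
    (s := {z : ℂ | 0 < z.re}) differentiable_neg.differentiableOn fun w hw =>
      hint (show (-w).re < 0 by simpa using hw)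
  exact (h2.congr fun w _ => (h1 w).symm) z hz

/-- A holomorphic function on the right half-plane that equals `1` on `(0, ∞)` is `1`. -/
theorem eq_one_of_eq_one_ofReal {h : ℂ → ℂ} (hd : DifferentiableOn ℂ h {z : ℂ | 0 < z.re})
    (h1 : ∀ t : ℝ, 0 < t → h t = 1) {z : ℂ} (hz : 0 < z.re) : h z = 1 := by
  have hopen : IsOpen {z : ℂ | 0 < z.re} := isOpen_lt continuous_const Complex.continuous_re
  have hconn : IsPreconnected {z : ℂ | 0 < z.re} := (convex_halfSpace_re_gt 0).isPreconnected
  refine (hd.analyticOnNhd hopen).eqOn_of_preconnected_of_frequently_eq (g := fun _ => 1) (z₀ := 1)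
    analyticOnNhd_const hconn (by simp) ?_ hz
  have hlim : Tendsto (fun t : ℝ => (t : ℂ)) (𝓝[>] 1) (𝓝[≠] 1) := by
    refine tendsto_nhdsWithin_iff.2 ⟨?_, ?_⟩
    · have : Tendsto (fun t : ℝ => (t : ℂ)) (𝓝 1) (𝓝 ((1 : ℝ) : ℂ)) :=
        Complex.continuous_ofReal.tendsto 1
      rw [Complex.ofReal_one] at this
      exact this.mono_left nhdsWithin_le_nhds
    · filter_upwards [self_mem_nhdsWithin] with t ht
      simpa using ne_of_gt ht
  refine hlim.frequently (Eventually.frequently ?_)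
  filter_upwards [self_mem_nhdsWithin] with t ht
  exact h1 t (one_pos.trans ht)

theorem integrable_cexp_neg (a : Measure ℝ≥0) [IsFiniteMeasure a] {z : ℂ} (hz : 0 < z.re) :
    Integrable (fun s : ℝ≥0 => Complex.exp (-(z * (s : ℝ)))) a := by
  refine Integrable.of_bound (C := 1) (by fun_prop) (ae_of_all _ fun s => ?_)
  rw [Complex.norm_exp]
  refine Real.exp_le_one_iff.2 ?_
  have : 0 ≤ z.re * s := mul_nonneg hz.le s.2
  simpa using this

theorem claplace_eq (a b c d : Measure ℝ≥0) [IsFiniteMeasure a] [IsFiniteMeasure b]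
    [IsFiniteMeasure c] [IsFiniteMeasure d] {z : ℂ} (hz : 0 < z.re) :
    claplace ((scaledMeasure 1 a - scaledMeasure 1 b) +
        (scaledMeasure Complex.I c - scaledMeasure Complex.I d)) z =
      (laplace a z - laplace b z) + Complex.I * (laplace c z - laplace d z) :=
  cintegral_eq a b c d (integrable_cexp_neg a hz) (integrable_cexp_neg b hz)
    (integrable_cexp_neg c hz) (integrable_cexp_neg d hz)

/-! ### Regularizers for `1/f` -/

namespace BoundedC0Semigroup

variable {X : Type*} [NormedAddCommGroup X] [NormedSpace ℂ X] [CompleteSpace X]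
  {T : BoundedC0Semigroup X}

/-- The Hille-Phillips calculus of a complex measure in terms of real and imaginary parts. -/
theorem exists_represents_hp (T : BoundedC0Semigroup X) (ν : ComplexMeasure ℝ≥0) :
    ∃ (G H : ℝ → ℝ) (B C : X →L[ℂ] X), T.Represents G B ∧ T.Represents H C ∧
      (∀ t : ℝ, 0 < t → claplace ν t = G t + Complex.I * H t) ∧
      ∀ x, T.hp ν x = B x + Complex.I • C x := by
  obtain ⟨a, b, c, d, ha, hb, hc, hd, rfl⟩ := exists_eq_scaledMeasure ν
  refine ⟨_, _, _, _, (T.represents_integ a).sub (T.represents_integ b),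
    (T.represents_integ c).sub (T.represents_integ d), fun t ht => ?_, fun x => ?_⟩
  · rw [claplace_eq a b c d (by simpa using ht)]
    simp only [laplace_ofReal, Complex.ofReal_sub]
  · exact cintegral_eq a b c d (T.integrable_orbit a x) (T.integrable_orbit b x)
      (T.integrable_orbit c x) (T.integrable_orbit d x)

/-- Because `f` is real on `(0, ∞)`, the regularizer equation splits there into real and imaginary
parts, each covered by `apply_eq_of_represents`. -/
theorem hp_eq_of_isRegularizer {μ : Measure ℝ≥0} (hμ : LaplaceTransformable μ)
    (hpos : ∀ t, 0 < t → 0 < laplaceReal μ t)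
    {x y : X} (hxy : ∀ φ : X →L[ℂ] ℂ,
      Tendsto (fun α : ℝ => φ (∫ s : ℝ≥0, Real.exp (-(α * s)) • T.op s x ∂μ))
        (𝓝[>] 0) (𝓝 (φ y)))
    {ν ρ : ComplexMeasure ℝ≥0} (h : T.IsRegularizer (fun z => 1 / laplace μ z) ν ρ) :
    T.hp ρ y = T.hp ν x := by
  obtain ⟨G, H, B, C, hB, hC, hL, hν⟩ := T.exists_represents_hp ν
  obtain ⟨G', H', B', C', hB', hC', hL', hρ⟩ := T.exists_represents_hp ρ
  have e : ∀ t : ℝ, 0 < t → G t = G' t * laplaceReal μ t ∧ H t = H' t * laplaceReal μ t := by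
    intro t ht
    have h1 := h.mul_eq t (by simpa using ht)
    have h2 : (laplaceReal μ t : ℂ) ≠ 0 := by exact_mod_cast (hpos t ht).ne'
    rw [laplace_ofReal, mul_one_div, div_eq_iff h2, hL t ht, hL' t ht] at h1
    have hre := congrArg Complex.re h1
    have him := congrArg Complex.im h1
    simp at hre him
    exact ⟨hre, him⟩
  rw [hν, hρ, apply_eq_of_represents hμ hxy hB hB' fun t ht => (e t ht).1,
    apply_eq_of_represents hμ hxy hC hC' fun t ht => (e t ht).2]

/-- The regularizer is `e = 1/(1+z)`. With increments at `α = 1`, `e g = (1 - e)(g(z+1) - g(1))/z +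
g(1) e - e (g(z+1) - g(z))` on `(0, ∞)`. -/
theorem isRegularizable_one_div_laplace (T : BoundedC0Semigroup X) {μ : Measure ℝ≥0}
    (hμ : LaplaceTransformable μ) {g : ℝ → ℝ} {D : ℕ → ℝ → ℝ} (hg : IsBernsteinPair g D)
    (hfg : ∀ t, 0 < t → 0 < g t ∧ laplaceReal μ t = 1 / g t) :
    T.IsRegularizable fun z => 1 / laplace μ z := by
  obtain ⟨σ, hσ, -, hσL⟩ := hg.exists_measure_sub one_pos
  obtain ⟨h, hh, -, hhL⟩ := hg.exists_measure_slope one_pos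
  have hE := T.represents_integ expMeasure
  have hG : T.Represents (fun t => g t / (1 + t)) _ :=
    (((T.represents_one.sub hE).mul (T.represents_integ h)).add
      ((hE.smul (g 1)).sub (hE.mul (T.represents_integ σ)))).congr fun t ht => by
        have e2 : laplaceReal h t = (g (t + 1) - g 1) / t := by
          rw [eq_div_iff ht.ne']; linarith [hhL t ht]
        rw [laplaceReal_expMeasure ht, hσL t ht, e2]
        have : 1 + t ≠ 0 := by positivity
        field_simp
        ring
  obtain ⟨a, b, ha, hb, hab, -⟩ := hG
  have hlt := fun (m : Measure ℝ≥0) [IsFiniteMeasure m] =>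
    (laplaceTransformable_of_isFiniteMeasure m).differentiableOn
  have hne : ∀ z : ℂ, 0 < z.re → 1 + z ≠ 0 := fun z hz h0 => by
    have := congrArg Complex.re h0
    simp at this
    linarith
  -- The identity theorem carries `(e g)(1+z) f = 1` from the half-line to the half-plane; in
  -- particular `f` has no zeros there.
  have hone : ∀ z : ℂ, 0 < z.re → (laplace a z - laplace b z) * (1 + z) * laplace μ z = 1 := by
    intro z hz
    refine eq_one_of_eq_one_ofReal (h := fun z => (laplace a z - laplace b z) * (1 + z) * laplace μ z)
      ((((hlt a).sub (hlt b)).mul (by fun_prop)).mul hμ.differentiableOn) (fun t ht => ?_) hz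
    have : (laplaceReal a t - laplaceReal b t) * (1 + t) * laplaceReal μ t = 1 := by
      rw [← hab t ht, (hfg t ht).2]
      have := (hfg t ht).1
      field_simp
    simp only [laplace_ofReal]
    exact_mod_cast this
  have hμ0 : ∀ z : ℂ, 0 < z.re → laplace μ z ≠ 0 := fun z hz h0 => by
    have := hone z hz
    simp [h0] at this
  refine ⟨(differentiableOn_const 1).div hμ.differentiableOn hμ0,
    (scaledMeasure 1 expMeasure - scaledMeasure 1 0) +
      (scaledMeasure Complex.I 0 - scaledMeasure Complex.I 0),
    (scaledMeasure 1 a - scaledMeasure 1 b) +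
      (scaledMeasure Complex.I 0 - scaledMeasure Complex.I 0), fun z hz => ?_, ?_⟩
  · have h0 : laplace 0 z = 0 := by simp [laplace]
    rw [claplace_eq _ _ _ _ hz, claplace_eq _ _ _ _ hz, laplace_expMeasure hz, h0]
    have h1 := hone z hz
    have h2 := hne z hz
    have h3 := hμ0 z hz
    field_simp
    simp only [sub_zero, mul_zero]
    linear_combination -h1
  · have : T.hp ((scaledMeasure 1 expMeasure - scaledMeasure 1 0) +
        (scaledMeasure Complex.I 0 - scaledMeasure Complex.I 0)) = T.integ expMeasure := by
      ext x
      have := cintegral_eq expMeasure 0 0 0 (T.integrable_orbit _ x) (T.integrable_orbit _ x)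
        (T.integrable_orbit _ x) (T.integrable_orbit _ x)
      rw [hp, this]
      simp [integ_apply]
    rw [this]
    exact integ_expMeasure_injective

end BoundedC0Semigroup

end Ergodic

end

/-! ### The main theorem -/

open Ergodic Ergodic.BoundedC0Semigroup in
theorem mainTheorem3 {X : Type*} [NormedAddCommGroup X] [NormedSpace ℂ X] [CompleteSpace X]
    (A : X →ₗ.[ℂ] X) (T : Ergodic.BoundedC0Semigroup X) (hA : T.IsGenerator (-A))
    (μ : Measure ℝ≥0) [IsLocallyFiniteMeasure μ] (hμ : Ergodic.LaplaceTransformable μ)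
    (hf : Ergodic.IsPotential (Ergodic.laplaceReal μ))
    (hf0 : Tendsto (Ergodic.laplaceReal μ) (𝓝[>] 0) atTop)
    (x y : X)
    (hxy : ∀ φ : X →L[ℂ] ℂ,
      Tendsto (fun α : ℝ => φ (∫ s : ℝ≥0, Real.exp (-(α * s)) • T.op s x ∂μ))
        (𝓝[>] 0) (𝓝 (φ y))) :
    (T.ExtHPEq (fun z => 1 / Ergodic.laplace μ z) y x ∧
      (fun t : ℝ => T.cesaro t x) =O[atTop] fun t : ℝ => 1 / Ergodic.laplaceReal μ (1 / t)) ∧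
    (Tendsto (fun t : ℝ => t / Ergodic.laplaceReal μ (1 / t)) atTop atTop →
      (fun t : ℝ => T.cesaro t x) =o[atTop] fun t : ℝ => 1 / Ergodic.laplaceReal μ (1 / t)) := by
  obtain ⟨g, D, hg, hfg⟩ := hf.exists_isBernsteinPair hf0
  obtain ⟨M, hM0, hM⟩ := T.exists_bound
  choose! S hS hSn using fun t (ht : 0 < t) => exists_represents_cesaro_mul hg hM ht
  have hgpos : ∀ t, 0 < t → 0 < g t := fun t ht => (hfg t ht).1
  -- The rigorous form of `C_t(A)x = (C_t g)(A)y`, from `C_t = (C_t g) f`.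
  have hcesaro : (fun t => S t y) =ᶠ[atTop] fun t => T.cesaro t x := by
    filter_upwards [eventually_gt_atTop 0] with t ht
    rw [← integ_cesaroMeasure ht]
    refine apply_eq_of_represents hμ hxy (T.represents_cesaro ht) (hS t ht) fun z hz => ?_
    rw [(hfg z hz).2, mul_assoc, mul_one_div_cancel (hgpos z hz).ne', mul_one]
  have hrate : (fun t => g (1 / t)) =ᶠ[atTop] fun t => 1 / laplaceReal μ (1 / t) := by
    filter_upwards [eventually_gt_atTop 0] with t ht
    rw [(hfg _ (one_div_pos.2 ht)).2, one_div_one_div]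
  refine ⟨⟨⟨T.isRegularizable_one_div_laplace hμ hg hfg, fun ν ρ h =>
    hp_eq_of_isRegularizer hμ (fun t ht => ?_) hxy h⟩, ?_⟩, fun hlim => ?_⟩
  · rw [(hfg t ht).2]
    exact one_div_pos.2 (hgpos t ht)
  · refine Asymptotics.IsBigO.congr' ?_ hcesaro hrate
    refine Asymptotics.IsBigO.of_bound ((M + (1 + M) * M + M * M) * ‖y‖) ?_
    filter_upwards [eventually_gt_atTop 0] with t ht
    rw [Real.norm_of_nonneg (hgpos _ (one_div_pos.2 ht)).le, mul_right_comm]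
    exact (S t).le_of_opNorm_le (hSn t ht) y
  · refine Asymptotics.IsLittleO.congr' ?_ hcesaro hrate
    refine isLittleO_cesaro_mul hM hgpos hS hSn (hlim.congr' ?_) (mem_closure_rangeSpan hμ hf0 hxy)
    filter_upwards [hrate] with t ht
    rw [ht, mul_one_div]
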